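/- Let $\mathcal X=\mathbb R^d$ with Lebesgue measure or $\mathcal X=\mathbb Z^d$ with counting measure, let $\mathcal H=L^2(\mathcal X)$, and let $H$ be a self-adjoint, possibly unbounded, operator on $\mathcal H$ (for example any self-adjoint realization of $-\Delta+V$ with $V$ real-valued, bounded or not). For an operator $A$ write $A(t)=e^{itH}Ae^{-itH}$, with domain $\{\psi: e^{-itH}\psi\in D(A)\}$. Let $Q=(Q_1,\dots,Q_d):\mathcal H\to\mathcal H^d$ be the position operator, $Q_j$ being multiplication by the coordinate $q_j$ on its maximal domain, and let $|Q|^p$ be multiplication by $\|q\|^p$ on its maximal domain. For $p>0$ and $\psi\in\mathcal H$ let $$M_p(t)=\big\||Q|^{p/2}(t)\psi\big\|^2\in[0,\infty],$$ with the value $\infty$ if $\psi\notin D(|Q|^{p/2}(t))$. For $f:\mathbb R\to[0,\infty]$ and $T>0$ define the Abel and Cesàro means $$f_A(T)=\frac2T\int_0^\infty e^{-2t/T}f(t)\,dt,\qquad f_C(T)=\frac1T\int_0^Tf(t)\,dt .$$ Say that $f$ has *$p$-norm growth* if there are $c,C>0$ with $ct^p\le f(t)\le Ct^p$ for all sufficiently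 large $t$, and that $f$ has *$p$-exponents one* if $$\limsup_{t\to\infty}\frac{\log f(t)}{p\log t}=\liminf_{t\to\infty}\frac{\log f(t)}{p\log t}=1 .$$ Write $\beta^\pm_\psi(p)$ for this $\limsup$ and $\liminf$ when $f=M_p$. The state $\psi$ has ballistic transport for the $p$-th moment in the norm-growth sense, the exponent sense, the Abel average norm-growth sense, or the Abel average exponent sense if, respectively, $M_p$ has $p$-norm growth, $M_p$ has $p$-exponents one, $(M_p)_A$ has $p$-norm growth, or $(M_p)_A$ has $p$-exponents one. The Cesàro-averaged version of each of these four notions is obtained by replacing $M_p$ with $(M_p)_C$, that is, by replacing $|Q|^p(t)$ in $M_p(t)=\langle\psi,|Q|^p(t)\psi\rangle$ with its Cesàro mean. The state $\psi$ has strong ballistic transport if $\psi\in D(Q(t))$ for all large $t$ and $Q(t)\psi/t$ converges in $\mathcal H^d$ to a nonzero vector, and strong ballistic transport for the $p$-th moment if $\psi\in D(|Q|^p(t))$ for all large $t$ and $|Q|^p(t)\psi/t^p$ converges in $\mathcal H$ to a nonzero vector. In the averaged versions of these two notions, $Q(t)\psi$ (resp. $|Q|^p(t)\psi$) is replaced by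 $\frac1T\int_0^TQ(t)\psi\,dt$ (resp. $\frac1T\int_0^T|Q|^p(t)\psi\,dt$) and $t\to\infty$ by $T\to\infty$; the existence of these integrals for all $T>0$ is part of the notion. Call $\psi$ *$p$-suitable* if $\sup_{0\le t\le T}M_p(t)<\infty$ for every $T>0$. Then for every $p>0$ and every $\psi\in\mathcal H$: 1. Let $W\subset\mathcal H$ be a set with $\beta^\pm_\phi(p)\le1$ for all $\phi\in W$. Let $P=(P_1,\dots,P_d)$ be a tuple of self-adjoint operators such that $Q_j(t)/t\to P_j$ in the strong resolvent sense as $t\to\infty$, for every $j$, and let $\ker P=\bigcap_j\ker P_j$. If $\ker P\cap W\subset\{0\}$, then $\beta^\pm_\phi(p)=1$ for all nonzero $\phi\in W$. 2. Strong ballistic transport implies ballistic transport in the norm-growth sense for the second moment; strong ballistic transport for the $p$-th moment implies ballistic transport in the norm-growth sense for the $2p$-th moment. 3. Norm-growth ballistic transport implies ballistic transport in the exponent sense (for the $p$-th moment). 4. If $\psi$ is $p$-suitable, norm-growth ballistic transport implies ballistic transport in the Abel average norm-growth sense. 5. Ballistic transport in the Abel average norm-growth sense implies ballistic transport in the Abel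 average exponent sense. 6. If $\psi$ is $p$-suitable, ballistic transport in the exponent sense implies ballistic transport in the Abel average exponent sense and in the Cesàro average exponent sense, that is, $(M_p)_A$ and $(M_p)_C$ have $p$-exponents one. 7. If $\psi$ is $p$-suitable, each of the four notions of ballistic transport for the $p$-th moment (norm-growth, exponent, Abel average norm-growth, Abel average exponent) implies its Cesàro-averaged version. If $\psi$ is $2$-suitable, strong ballistic transport implies averaged strong ballistic transport. If $\psi$ is $2p$-suitable, strong ballistic transport for the $p$-th moment implies averaged strong ballistic transport for the $p$-th moment. -/

import Mathlib

open MeasureTheory Filter Topology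
open scoped ENNReal NNReal

namespace BallisticTransport

noncomputable section

/-- The counting measure of the lattice `ℤ^d ⊆ ℝ^d`. Its `L²` space is `ℓ²(ℤ^d)`, and the position
of the lattice point `n` is the vector `n ∈ ℝ^d`. -/
def latticeMeasure (d : ℕ) : Measure (EuclideanSpace ℝ (Fin d)) :=
  Measure.sum fun n : Fin d → ℤ => Measure.dirac (WithLp.toLp 2 fun i => (n i : ℝ))

/-- The Hilbert space of states: `L²(ℝ^d)` for Lebesgue measure `μ = volume`, and `ℓ²(ℤ^d)` for
`μ = latticeMeasure d`. -/
abbrev StateSpace {d : ℕ} (μ : Measure (EuclideanSpace ℝ (Fin d))) : Type := Lp ℂ 2 μ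

section Operators

variable {E : Type*} [NormedAddCommGroup E] [InnerProductSpace ℂ E]

/-- `U` is the strongly continuous one-parameter unitary group `t ↦ e^{-itH}`, that is, the one
whose infinitesimal generator, with its full domain, is `-iH`. For self-adjoint `H` there is
exactly one such group (Stone's theorem). -/
structure IsUnitaryGroupOf (H : E →ₗ.[ℂ] E) (U : ℝ → E ≃ₗᵢ[ℂ] E) : Prop where
  map_add : ∀ (s t : ℝ) (ψ : E), U (s + t) ψ = U s (U t ψ)
  continuous : ∀ ψ : E, Continuous fun t => U t ψ
  generator : ∀ ψ φ : E,
    (ψ, φ) ∈ H.graph ↔ HasDerivAt (fun t : ℝ => U t ψ) (-Complex.I • φ) 0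

open Classical in
/-- The propagator `e^{-itH}`: the unitary group generated by `-iH`. (The default value `1` is
never used for self-adjoint `H`, by Stone's theorem.) -/
def propagator (H : E →ₗ.[ℂ] E) : ℝ → E ≃ₗᵢ[ℂ] E :=
  if h : ∃ U : ℝ → E ≃ₗᵢ[ℂ] E, IsUnitaryGroupOf H U then h.choose
  else fun _ => LinearIsometryEquiv.refl ℂ E

/-- The Heisenberg evolution `A(t) = e^{itH} A e^{-itH}` of an unbounded operator `A`, with domain
`{ψ | e^{-itH} ψ ∈ D(A)}`. -/
def heisenberg (H A : E →ₗ.[ℂ] E) (t : ℝ) : E →ₗ.[ℂ] E where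
  domain := A.domain.comap ((propagator H t).toLinearEquiv : E →ₗ[ℂ] E)
  toFun :=
    { toFun := fun ψ => (propagator H t).symm (A ⟨propagator H t ψ, ψ.2⟩)
      map_add' := fun ψ φ => by
        rw [← map_add, ← A.map_add]
        congr 2
        exact Subtype.ext (map_add (propagator H t) (ψ : E) (φ : E))
      map_smul' := fun c ψ => by
        rw [RingHom.id_apply, ← map_smul, ← A.map_smul]
        congr 2
        exact Subtype.ext (map_smul (propagator H t) c (ψ : E)) }

open Classical in
/-- The value `A ψ`, extended by `0` outside the domain of `A`. -/
def evalOrZero (A : E →ₗ.[ℂ] E) (ψ : E) : E :=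
  if h : ψ ∈ A.domain then A ⟨ψ, h⟩ else 0

open Classical in
/-- The resolvent `(A - z)⁻¹ φ`: the element `η` of `D(A)` with `A η - z η = φ`. For self-adjoint
`A` and `z ∉ ℝ` it exists and is unique for every `φ`. -/
def resolventAt (A : E →ₗ.[ℂ] E) (z : ℂ) (φ : E) : E :=
  if h : ∃ η : A.domain, A η - z • (η : E) = φ then (h.choose : E) else 0

/-- `A t → P` in the strong resolvent sense as `t → ∞`. -/
def StrongResolventTendsto (A : ℝ → E →ₗ.[ℂ] E) (P : E →ₗ.[ℂ] E) : Prop :=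
  ∀ z : ℂ, z.im ≠ 0 → ∀ φ : E,
    Tendsto (fun t => resolventAt (A t) z φ) atTop (𝓝 (resolventAt P z φ))

/-- `ψ ∈ ker A`. -/
def InKernel (A : E →ₗ.[ℂ] E) (ψ : E) : Prop := ∃ h : ψ ∈ A.domain, A ⟨ψ, h⟩ = 0

/-- Strong transport for a finite family of operators `A = (A_j)_j` at the rate `t^r`: `ψ` is in the
domain of `A(t)` for all large `t`, and `A(t) ψ / t^r` converges to a nonzero vector `P` of
the corresponding power of the Hilbert space. -/
def StrongTransportFor {ι : Type} [Finite ι] (H : E →ₗ.[ℂ] E) (A : ι → E →ₗ.[ℂ] E) (r : ℝ)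
    (ψ : E) : Prop :=
  ∃ P : ι → E, P ≠ 0 ∧
    (∀ j, ∀ᶠ t : ℝ in atTop, ψ ∈ (heisenberg H (A j) t).domain) ∧
    ∀ j, Tendsto (fun t : ℝ => ((t ^ r)⁻¹ : ℝ) • evalOrZero (heisenberg H (A j) t) ψ)
      atTop (𝓝 (P j))

/-- The Cesàro average `(1/T) ∫₀ᵀ A(t) ψ dt`. -/
def cesaroOperator (H A : E →ₗ.[ℂ] E) (T : ℝ) (ψ : E) : E :=
  (T⁻¹ : ℝ) • ∫ t in (0 : ℝ)..T, evalOrZero (heisenberg H A t) ψ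

/-- The averaged version of `StrongTransportFor`, with `A(t)` replaced by its Cesàro average
`(1/T) ∫₀ᵀ A(t) dt`. The integrals are required to exist. -/
def AveragedStrongTransportFor {ι : Type} [Finite ι] (H : E →ₗ.[ℂ] E) (A : ι → E →ₗ.[ℂ] E)
    (r : ℝ) (ψ : E) : Prop :=
  ∃ P : ι → E, P ≠ 0 ∧
    (∀ j, ∀ᵐ t ∂(volume.restrict (Set.Ioi (0 : ℝ))), ψ ∈ (heisenberg H (A j) t).domain) ∧
    (∀ j, ∀ T : ℝ, 0 < T →
      IntervalIntegrable (fun t => evalOrZero (heisenberg H (A j) t) ψ) volume 0 T) ∧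
    ∀ j, Tendsto (fun T : ℝ => ((T ^ r)⁻¹ : ℝ) • cesaroOperator H (A j) T ψ) atTop (𝓝 (P j))

end Operators

section Growth

/-- Two-sided power bounds `c t^p ≤ f(t) ≤ C t^p` for all large `t`. -/
def NormGrowth (p : ℝ) (f : ℝ → ℝ≥0∞) : Prop :=
  ∃ c C : ℝ, 0 < c ∧ 0 < C ∧ ∀ᶠ t : ℝ in atTop,
    ENNReal.ofReal (c * t ^ p) ≤ f t ∧ f t ≤ ENNReal.ofReal (C * t ^ p)

/-- `limsup_{t → ∞} log f(t) / (p log t)`, in `[-∞, ∞]`. -/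
def upperExponent (p : ℝ) (f : ℝ → ℝ≥0∞) : EReal :=
  limsup (fun t : ℝ => ENNReal.log (f t) / ((p * Real.log t : ℝ) : EReal)) atTop

/-- `liminf_{t → ∞} log f(t) / (p log t)`, in `[-∞, ∞]`. -/
def lowerExponent (p : ℝ) (f : ℝ → ℝ≥0∞) : EReal :=
  liminf (fun t : ℝ => ENNReal.log (f t) / ((p * Real.log t : ℝ) : EReal)) atTop

/-- Both exponents are `1`. -/
def ExponentsEqOne (p : ℝ) (f : ℝ → ℝ≥0∞) : Prop :=
  upperExponent p f = 1 ∧ lowerExponent p f = 1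

/-- The Abel average `(2/T) ∫₀^∞ e^{-2t/T} f(t) dt`, for `T > 0`. -/
def abelMean (f : ℝ → ℝ≥0∞) (T : ℝ) : ℝ≥0∞ :=
  ENNReal.ofReal (2 / T) *
    ∫⁻ t in Set.Ioi (0 : ℝ), ENNReal.ofReal (Real.exp (-(2 * t) / T)) * f t

/-- The Cesàro average `(1/T) ∫₀ᵀ f(t) dt`, for `T > 0`. -/
def cesaroMean (f : ℝ → ℝ≥0∞) (T : ℝ) : ℝ≥0∞ :=
  ENNReal.ofReal (1 / T) * ∫⁻ t in Set.Ioc (0 : ℝ) T, f t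

end Growth

section Position

variable {d : ℕ} {μ : Measure (EuclideanSpace ℝ (Fin d))}

/-- Multiplication by the real function `f` on its maximal domain `{ψ | f ψ ∈ L²}`. -/
def mulOperator (f : EuclideanSpace ℝ (Fin d) → ℝ) : StateSpace μ →ₗ.[ℂ] StateSpace μ where
  domain :=
    { carrier := {ψ | MemLp (fun x => (f x : ℂ) * ψ x) 2 μ}
      zero_mem' := by
        refine (MemLp.zero' (p := 2) (μ := μ) (ε := ℂ)).ae_eq ?_
        filter_upwards [Lp.coeFn_zero ℂ 2 μ] with x hx
        change (0 : ℂ) = (f x : ℂ) * (0 : StateSpace μ) x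
        rw [hx, Pi.zero_apply, mul_zero]
      add_mem' := by
        intro ψ φ hψ hφ
        refine (MemLp.add hψ hφ).ae_eq ?_
        filter_upwards [Lp.coeFn_add ψ φ] with x hx
        change (f x : ℂ) * ψ x + (f x : ℂ) * φ x = (f x : ℂ) * (ψ + φ : StateSpace μ) x
        rw [hx, Pi.add_apply, mul_add]
      smul_mem' := by
        intro c ψ hψ
        refine (MemLp.const_smul hψ c).ae_eq ?_
        filter_upwards [Lp.coeFn_smul c ψ] with x hx
        simp [hx, mul_left_comm] }
  toFun :=
    { toFun := fun ψ => MemLp.toLp (fun x => (f x : ℂ) * (ψ : StateSpace μ) x) ψ.2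
      map_add' := by
        rintro ⟨ψ, hψ⟩ ⟨φ, hφ⟩
        rw [← MemLp.toLp_add]
        refine MemLp.toLp_congr _ _ ?_
        filter_upwards [Lp.coeFn_add ψ φ] with x hx
        change (f x : ℂ) * (ψ + φ : StateSpace μ) x = (f x : ℂ) * ψ x + (f x : ℂ) * φ x
        rw [hx, Pi.add_apply, mul_add]
      map_smul' := by
        rintro c ⟨ψ, hψ⟩
        rw [RingHom.id_apply, ← MemLp.toLp_const_smul]
        refine MemLp.toLp_congr _ _ ?_
        filter_upwards [Lp.coeFn_smul c ψ] with x hx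
        simp [hx, mul_left_comm] }

/-- The `j`-th component `Q_j` of the position operator `Q = (Q_1, …, Q_d)`. -/
def position (j : Fin d) : StateSpace μ →ₗ.[ℂ] StateSpace μ := mulOperator fun x => x j

/-- The operator `|Q|^p` of multiplication by the `p`-th power of the Euclidean norm. -/
def absPositionPow (p : ℝ) : StateSpace μ →ₗ.[ℂ] StateSpace μ := mulOperator fun x => ‖x‖ ^ p

/-- The `p`-th moment `‖|Q|^{p/2}(t) ψ‖² = ∫ |q|^p |(e^{-itH} ψ)(q)|² dμ(q)`, which is `∞` if `ψ` is
not in the domain of `|Q|^{p/2}(t)`. -/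
def moment (H : StateSpace μ →ₗ.[ℂ] StateSpace μ) (p : ℝ) (ψ : StateSpace μ) (t : ℝ) : ℝ≥0∞ :=
  ∫⁻ x, ‖x‖ₑ ^ p * ‖(propagator H t ψ) x‖ₑ ^ (2 : ℕ) ∂μ

/-- The `p`-th moment of `ψ` is finite at all times `t ≥ 0`, and bounded on bounded time
intervals. -/
def LocallyBoundedMoment (H : StateSpace μ →ₗ.[ℂ] StateSpace μ) (p : ℝ) (ψ : StateSpace μ) :
    Prop :=
  ∀ T : ℝ, ∃ C : ℝ≥0, ∀ t ∈ Set.Icc (0 : ℝ) T, moment H p ψ t ≤ C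

/-- Strong ballistic transport: `Q(t) ψ / t → P_ψ ≠ 0`. -/
def StrongTransport (H : StateSpace μ →ₗ.[ℂ] StateSpace μ) (ψ : StateSpace μ) : Prop :=
  StrongTransportFor H (fun j : Fin d => position j) 1 ψ

/-- Averaged strong ballistic transport: `⟨Q⟩(T) ψ / T` tends to a nonzero vector. -/
def AveragedStrongTransport (H : StateSpace μ →ₗ.[ℂ] StateSpace μ) (ψ : StateSpace μ) : Prop :=
  AveragedStrongTransportFor H (fun j : Fin d => position j) 1 ψ

/-- Strong ballistic transport for the `p`-th moment: `|Q|^p(t) ψ / t^p → P_ψ ≠ 0`. -/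
def StrongMomentTransport (H : StateSpace μ →ₗ.[ℂ] StateSpace μ) (p : ℝ) (ψ : StateSpace μ) :
    Prop :=
  StrongTransportFor H (fun _ : Unit => absPositionPow p) p ψ

/-- Averaged strong ballistic transport for the `p`-th moment. -/
def AveragedStrongMomentTransport (H : StateSpace μ →ₗ.[ℂ] StateSpace μ) (p : ℝ)
    (ψ : StateSpace μ) : Prop :=
  AveragedStrongTransportFor H (fun _ : Unit => absPositionPow p) p ψ

end Position

end

end BallisticTransport

open BallisticTransport

namespace BallisticTransport

/-! ### Power bounds, logarithmic exponents and scalar means. -/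

section Growth

/-! All statements about moments reduce to one-sided power bounds. By `exponentsEqOne_iff`,
exponents one means a lower bound of order `t^q` for every `0 < q < p` and an upper bound for every
`q > p`, so norm growth and exponents are both transferred to means by the same lemmas on
`LowerGrowth q` and `UpperGrowth q`. Lower bounds survive averaging because a window of length
comparable to `T` carries enough mass; upper bounds need local boundedness to control small times.

Averages of averages need a comparison that uses no pointwise growth of `f`. From above, the Cesàro
mean is at most a constant times the Abel mean. From below, Tonelli turns the Abel mean of the
Cesàro mean into an integral of `f` whose kernel dominates the Abel kernel at time `T/2`
(`abelMean_le_abelMean_cesaroMean`).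

Strong transport gives norm growth since the squared norms of the evolved vectors add up to the
moment. Its averaged form holds because a curve asymptotic to `t^r P` has Cesàro mean asymptotic to
`T^r P / (r + 1)`.

For strong resolvent limits, `(P - i)⁻¹` strictly shrinks every vector outside `ker P`
(`norm_resolventAt_I_lt`). By convergence the resolvent of `Q_j(t)/t` loses a fixed amount of mass
for large `t`. Little of it can be lost where `|q_j| ≤ δ t`, so some mass lies at distance at least
`δ t`, and the moment is at least of order `t^p`. -/

/-- `f` is eventually bounded below by a positive multiple of `t^q`. -/
def LowerGrowth (q : ℝ) (f : ℝ → ℝ≥0∞) : Prop :=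
  ∃ c : ℝ, 0 < c ∧ ∀ᶠ t : ℝ in atTop, ENNReal.ofReal (c * t ^ q) ≤ f t

/-- `f` is eventually bounded above by a multiple of `t^q`. -/
def UpperGrowth (q : ℝ) (f : ℝ → ℝ≥0∞) : Prop :=
  ∃ C : ℝ, 0 < C ∧ ∀ᶠ t : ℝ in atTop, f t ≤ ENNReal.ofReal (C * t ^ q)

/-- `f` is bounded on every interval `[0, T]`. -/
def LocallyBounded (f : ℝ → ℝ≥0∞) : Prop :=
  ∀ T : ℝ, ∃ C : ℝ≥0, ∀ t ∈ Set.Icc (0 : ℝ) T, f t ≤ C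

theorem normGrowth_iff {p : ℝ} {f : ℝ → ℝ≥0∞} :
    NormGrowth p f ↔ LowerGrowth p f ∧ UpperGrowth p f := by
  constructor
  · rintro ⟨c, C, hc, hC, h⟩
    exact ⟨⟨c, hc, h.mono fun _ h => h.1⟩, ⟨C, hC, h.mono fun _ h => h.2⟩⟩
  · rintro ⟨⟨c, hc, h⟩, ⟨C, hC, h'⟩⟩
    exact ⟨c, C, hc, hC, h.and h'⟩

theorem LowerGrowth.mono_exponent {q r : ℝ} {f : ℝ → ℝ≥0∞} (hf : LowerGrowth q f) (h : r ≤ q) :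
    LowerGrowth r f := by
  obtain ⟨c, hc, hf⟩ := hf
  refine ⟨c, hc, ?_⟩
  filter_upwards [hf, eventually_ge_atTop 1] with t ht h1
  exact le_trans (by gcongr) ht

theorem UpperGrowth.mono_exponent {q r : ℝ} {f : ℝ → ℝ≥0∞} (hf : UpperGrowth q f) (h : q ≤ r) :
    UpperGrowth r f := by
  obtain ⟨c, hc, hf⟩ := hf
  refine ⟨c, hc, ?_⟩
  filter_upwards [hf, eventually_ge_atTop 1] with t ht h1
  exact ht.trans (by gcongr)

/-- The logarithmic quotient is at least `a` exactly if `f(t) ≥ t^{ap}`. -/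
theorem le_log_div_iff {p a t : ℝ} (hp : 0 < p) (ht : 1 < t) (x : ℝ≥0∞) :
    (a : EReal) ≤ ENNReal.log x / ((p * Real.log t : ℝ) : EReal) ↔
      ENNReal.ofReal (t ^ (a * p)) ≤ x := by
  have h0 : 0 < p * Real.log t := mul_pos hp (Real.log_pos ht)
  rw [EReal.le_div_iff_mul_le (by exact_mod_cast h0) (EReal.coe_ne_top _), ← EReal.coe_mul,
    ← ENNReal.log_le_log_iff, ENNReal.log_ofReal_of_pos (by positivity),
    Real.log_rpow (by positivity), mul_assoc]

/-- The logarithmic quotient is at most `a` exactly if `f(t) ≤ t^{ap}`. -/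
theorem log_div_le_iff {p a t : ℝ} (hp : 0 < p) (ht : 1 < t) (x : ℝ≥0∞) :
    ENNReal.log x / ((p * Real.log t : ℝ) : EReal) ≤ (a : EReal) ↔
      x ≤ ENNReal.ofReal (t ^ (a * p)) := by
  have h0 : 0 < p * Real.log t := mul_pos hp (Real.log_pos ht)
  rw [EReal.div_le_iff_le_mul (by exact_mod_cast h0) (EReal.coe_ne_top _), ← EReal.coe_mul,
    ← ENNReal.log_le_log_iff, ENNReal.log_ofReal_of_pos (by positivity),
    Real.log_rpow (by positivity)]
  ring_nf

theorem upperExponent_le_one_iff {p : ℝ} (hp : 0 < p) {f : ℝ → ℝ≥0∞} :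
    upperExponent p f ≤ 1 ↔ ∀ q, p < q → UpperGrowth q f := by
  constructor
  · intro h q hq
    have h1 : upperExponent p f < ((q / p : ℝ) : EReal) := by
      refine h.trans_lt ?_
      exact_mod_cast (one_lt_div hp).2 hq
    refine ⟨1, one_pos, ?_⟩
    filter_upwards [eventually_lt_of_limsup_lt h1, eventually_gt_atTop 1] with t ht h2
    have := (log_div_le_iff hp h2 _).1 ht.le
    rwa [div_mul_cancel₀ _ hp.ne', ← one_mul (t ^ q)] at this
  · intro h
    refine EReal.le_of_forall_lt_iff_le.1 fun a ha => ?_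
    have ha : 1 < a := by exact_mod_cast ha
    -- An exponent halfway between `p` and `a p`; the remaining gap `p (a - 1) / 2` absorbs the
    -- constant `C`.
    obtain ⟨C, hC, h⟩ := h (p * (1 + a) / 2) (by nlinarith)
    have hpos : 0 < p * (a - 1) / 2 := by have := sub_pos.2 ha; positivity
    refine limsup_le_of_le (by isBoundedDefault) ?_
    filter_upwards [h, eventually_gt_atTop 1,
      (tendsto_rpow_atTop hpos).eventually_ge_atTop C] with t ht h1 h2
    refine (log_div_le_iff hp h1 _).2 (ht.trans (ENNReal.ofReal_le_ofReal ?_))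
    calc C * t ^ (p * (1 + a) / 2) ≤ t ^ (p * (a - 1) / 2) * t ^ (p * (1 + a) / 2) := by gcongr
      _ = t ^ (a * p) := by rw [← Real.rpow_add (by positivity)]; ring_nf

theorem one_le_lowerExponent_iff {p : ℝ} (hp : 0 < p) {f : ℝ → ℝ≥0∞} :
    1 ≤ lowerExponent p f ↔ ∀ q, 0 < q → q < p → LowerGrowth q f := by
  constructor
  · intro h q _ hq
    have h1 : ((q / p : ℝ) : EReal) < lowerExponent p f := by
      refine lt_of_lt_of_le ?_ h
      exact_mod_cast (div_lt_one hp).2 hq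
    refine ⟨1, one_pos, ?_⟩
    filter_upwards [eventually_lt_of_lt_liminf h1, eventually_gt_atTop 1] with t ht h2
    have := (le_log_div_iff hp h2 _).1 ht.le
    rwa [div_mul_cancel₀ _ hp.ne', ← one_mul (t ^ q)] at this
  · intro h
    refine EReal.ge_of_forall_gt_iff_ge.1 fun a ha => ?_
    have ha : a < 1 := by exact_mod_cast ha
    -- Here `a` may be negative, while lower growth is only assumed for positive exponents.
    obtain ⟨b, hb, hb1⟩ : ∃ b, max a 0 < b ∧ b < 1 := exists_between (max_lt ha one_pos)
    obtain ⟨hab, hb0⟩ := max_lt_iff.1 hb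
    obtain ⟨c, hc, h⟩ := h (p * b) (by positivity) (by nlinarith)
    have hpos : 0 < p * (b - a) := by have := sub_pos.2 hab; positivity
    refine le_liminf_of_le (by isBoundedDefault) ?_
    filter_upwards [h, eventually_gt_atTop 1,
      (tendsto_rpow_atTop hpos).eventually_ge_atTop c⁻¹] with t ht h1 h2
    refine (le_log_div_iff hp h1 _).2 (le_trans (ENNReal.ofReal_le_ofReal ?_) ht)
    calc t ^ (a * p) = 1 * t ^ (a * p) := (one_mul _).symm
      _ ≤ c * t ^ (p * (b - a)) * t ^ (a * p) := by
        gcongr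
        rw [inv_le_iff_one_le_mul₀ hc] at h2
        linarith
      _ = c * t ^ (p * b) := by rw [mul_assoc, ← Real.rpow_add (by positivity)]; ring_nf

theorem exponentsEqOne_of_bounds {p : ℝ} {f : ℝ → ℝ≥0∞} (hu : upperExponent p f ≤ 1)
    (hl : 1 ≤ lowerExponent p f) : ExponentsEqOne p f := by
  have h : lowerExponent p f ≤ upperExponent p f := liminf_le_limsup
  exact ⟨hu.antisymm (hl.trans h), (h.trans hu).antisymm hl⟩

/-- Removes logarithms and limits from the exponent notions. Keeping `q` positive makes `t^q`
increasing, as the estimates for means require. -/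
theorem exponentsEqOne_iff {p : ℝ} (hp : 0 < p) {f : ℝ → ℝ≥0∞} :
    ExponentsEqOne p f ↔
      (∀ q, 0 < q → q < p → LowerGrowth q f) ∧ ∀ q, p < q → UpperGrowth q f := by
  rw [← one_le_lowerExponent_iff hp, ← upperExponent_le_one_iff hp]
  exact ⟨fun h => ⟨h.2.ge, h.1.le⟩, fun h => exponentsEqOne_of_bounds h.2 h.1⟩

theorem NormGrowth.exponentsEqOne {p : ℝ} (hp : 0 < p) {f : ℝ → ℝ≥0∞} (h : NormGrowth p f) :
    ExponentsEqOne p f := by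
  obtain ⟨hl, hu⟩ := normGrowth_iff.1 h
  exact (exponentsEqOne_iff hp).2
    ⟨fun q _ hq => hl.mono_exponent hq.le, fun q hq => hu.mono_exponent hq.le⟩

/-! ### Power bounds pass to Cesàro and Abel means. -/

/-- A locally bounded function of growth at most `t^q` is at most `C (1 + t^q)` for all `t ≥ 0`. -/
theorem UpperGrowth.exists_global_bound {q : ℝ} {f : ℝ → ℝ≥0∞} (hb : LocallyBounded f)
    (hf : UpperGrowth q f) :
    ∃ C : ℝ, 0 < C ∧ ∀ t, 0 ≤ t → f t ≤ ENNReal.ofReal (C * (1 + t ^ q)) := by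
  obtain ⟨C, hC, hf⟩ := hf
  obtain ⟨T, hT⟩ := eventually_atTop.1 hf
  obtain ⟨B, hB⟩ := hb T
  refine ⟨C + B, by positivity, fun t ht => ?_⟩
  have hq : 0 ≤ t ^ q := Real.rpow_nonneg ht q
  have hB0 : (0 : ℝ) ≤ B := B.2
  rcases le_total t T with h | h
  · refine (hB t ⟨ht, h⟩).trans ?_
    rw [← ENNReal.ofReal_coe_nnreal]
    exact ENNReal.ofReal_le_ofReal (by nlinarith [mul_nonneg hC.le hq, mul_nonneg hB0 hq])
  · exact (hT t h).trans (ENNReal.ofReal_le_ofReal (by nlinarith [mul_nonneg hB0 hq]))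

/-- The window `(T/2, T]` alone gives the bound: there `f` is at least `c (T/2)^q`. -/
theorem LowerGrowth.cesaroMean {q : ℝ} (hq : 0 < q) {f : ℝ → ℝ≥0∞} (hf : LowerGrowth q f) :
    LowerGrowth q (cesaroMean f) := by
  obtain ⟨c, hc, hf⟩ := hf
  obtain ⟨T₀, hT₀⟩ := eventually_atTop.1 hf
  refine ⟨c * (1 / 2) ^ q / 2, by positivity, ?_⟩
  filter_upwards [eventually_ge_atTop (2 * T₀), eventually_gt_atTop 0] with T hT hT0
  have hlow : ENNReal.ofReal (c * (T / 2) ^ q) * ENNReal.ofReal (T - T / 2) ≤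
      ∫⁻ t in Set.Ioc (0 : ℝ) T, f t := by
    calc _ = ∫⁻ _ in Set.Ioc (T / 2) T, ENNReal.ofReal (c * (T / 2) ^ q) := by
          rw [setLIntegral_const, Real.volume_Ioc]
      _ ≤ ∫⁻ t in Set.Ioc (T / 2) T, f t := by
          refine setLIntegral_mono' measurableSet_Ioc fun t ht => ?_
          refine le_trans (ENNReal.ofReal_le_ofReal ?_) (hT₀ t (by linarith [ht.1]))
          have := ht.1
          gcongr
      _ ≤ _ := lintegral_mono_set (Set.Ioc_subset_Ioc_left (by positivity))
  refine le_trans (le_of_eq ?_) (mul_le_mul_right hlow (ENNReal.ofReal (1 / T)))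
  rw [← ENNReal.ofReal_mul (by positivity), ← ENNReal.ofReal_mul (by positivity)]
  congr 1
  rw [div_eq_mul_one_div T 2, Real.mul_rpow hT0.le (by norm_num)]
  field_simp
  ring

theorem UpperGrowth.cesaroMean {q : ℝ} (hq : 0 < q) {f : ℝ → ℝ≥0∞} (hb : LocallyBounded f)
    (hf : UpperGrowth q f) : UpperGrowth q (cesaroMean f) := by
  obtain ⟨C, hC, hf⟩ := hf.exists_global_bound hb
  refine ⟨C * 2, by positivity, ?_⟩
  filter_upwards [eventually_ge_atTop 1] with T hT
  have hT0 : 0 < T := by linarith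
  have hup : ∫⁻ t in Set.Ioc (0 : ℝ) T, f t ≤
      ENNReal.ofReal (C * (2 * T ^ q)) * ENNReal.ofReal (T - 0) := by
    rw [← Real.volume_Ioc, ← setLIntegral_const]
    refine setLIntegral_mono' measurableSet_Ioc fun t ht => (hf t ht.1.le).trans ?_
    refine ENNReal.ofReal_le_ofReal ?_
    have h1 : t ^ q ≤ T ^ q := Real.rpow_le_rpow ht.1.le ht.2 hq.le
    have h2 : 1 ≤ T ^ q := Real.one_le_rpow hT hq.le
    gcongr
    linarith
  refine (mul_le_mul_right hup (ENNReal.ofReal (1 / T))).trans (le_of_eq ?_)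
  rw [← ENNReal.ofReal_mul (by positivity), ← ENNReal.ofReal_mul (by positivity)]
  congr 1
  field_simp
  ring

/-- On the window `(T, 2T]` the weight is at least `e^{-4}` and `f` is at least `c T^q`. -/
theorem LowerGrowth.abelMean {q : ℝ} (hq : 0 < q) {f : ℝ → ℝ≥0∞} (hf : LowerGrowth q f) :
    LowerGrowth q (abelMean f) := by
  obtain ⟨c, hc, hf⟩ := hf
  obtain ⟨T₀, hT₀⟩ := eventually_atTop.1 hf
  refine ⟨2 * Real.exp (-4) * c, by positivity, ?_⟩
  filter_upwards [eventually_ge_atTop T₀, eventually_gt_atTop 0] with T hT hT0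
  have hlow : ENNReal.ofReal (Real.exp (-4) * (c * T ^ q)) * ENNReal.ofReal (2 * T - T) ≤
      ∫⁻ t in Set.Ioi (0 : ℝ), ENNReal.ofReal (Real.exp (-(2 * t) / T)) * f t := by
    calc _ = ∫⁻ _ in Set.Ioc T (2 * T), ENNReal.ofReal (Real.exp (-4) * (c * T ^ q)) := by
          rw [setLIntegral_const, Real.volume_Ioc]
      _ ≤ ∫⁻ t in Set.Ioc T (2 * T), ENNReal.ofReal (Real.exp (-(2 * t) / T)) * f t := by
          refine setLIntegral_mono' measurableSet_Ioc fun t ht => ?_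
          rw [ENNReal.ofReal_mul (by positivity)]
          refine mul_le_mul' (ENNReal.ofReal_le_ofReal ?_)
            (le_trans (ENNReal.ofReal_le_ofReal ?_) (hT₀ t (by linarith [ht.1])))
          · rw [Real.exp_le_exp, le_div_iff₀ hT0]
            linarith [ht.2]
          · have := ht.1
            gcongr
      _ ≤ _ := lintegral_mono_set fun t ht => hT0.trans ht.1
  refine le_trans (le_of_eq ?_) (mul_le_mul_right hlow (ENNReal.ofReal (2 / T)))
  rw [← ENNReal.ofReal_mul (by positivity), ← ENNReal.ofReal_mul (by positivity)]
  congr 1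
  field_simp
  ring

theorem lintegral_exp_neg_div {T : ℝ} (hT : 0 < T) :
    ∫⁻ t in Set.Ioi (0 : ℝ), ENNReal.ofReal (Real.exp (-t / T)) = ENNReal.ofReal T := by
  have ha : -T⁻¹ < 0 := by simpa using hT
  have h := integral_exp_mul_Ioi ha 0
  have h' : ∀ t : ℝ, -t / T = -T⁻¹ * t := fun t => by field_simp
  simp_rw [h']
  rw [← ofReal_integral_eq_lintegral_ofReal (integrableOn_exp_mul_Ioi ha 0)
    (ae_of_all _ fun t => (Real.exp_pos _).le), h]
  simp

/-- Raise `x/q ≤ e^{x/q}` to the power `q`. -/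
theorem rpow_le_mul_exp {q x : ℝ} (hq : 0 < q) (hx : 0 ≤ x) : x ^ q ≤ q ^ q * Real.exp x := by
  calc x ^ q = q ^ q * (x / q) ^ q := by
        rw [← Real.mul_rpow hq.le (by positivity), mul_div_cancel₀ _ hq.ne']
    _ ≤ q ^ q * Real.exp (x / q) ^ q := by
        gcongr
        linarith [Real.add_one_le_exp (x / q)]
    _ = q ^ q * Real.exp x := by rw [← Real.exp_mul, div_mul_cancel₀ _ hq.ne']

/-- Half of the decay `e^{-2t/T}` is spent on `1 + t^q`, which is at most a constant times `e^{t/T}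
T^q`; the other half has integral `T` and cancels the prefactor up to the factor `2`. -/
theorem UpperGrowth.abelMean {q : ℝ} (hq : 0 < q) {f : ℝ → ℝ≥0∞} (hb : LocallyBounded f)
    (hf : UpperGrowth q f) : UpperGrowth q (abelMean f) := by
  obtain ⟨C, hC, hf⟩ := hf.exists_global_bound hb
  refine ⟨2 * (C * (1 + q ^ q)), by positivity, ?_⟩
  filter_upwards [eventually_ge_atTop 1] with T hT
  have hT0 : 0 < T := by linarith
  have hup : ∫⁻ t in Set.Ioi (0 : ℝ), ENNReal.ofReal (Real.exp (-(2 * t) / T)) * f t ≤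
      ENNReal.ofReal (C * (1 + q ^ q) * T ^ q) * ENNReal.ofReal T := by
    rw [← lintegral_exp_neg_div hT0, ← lintegral_const_mul' _ _ ENNReal.ofReal_ne_top]
    refine setLIntegral_mono' measurableSet_Ioi fun t ht => ?_
    have ht : 0 < t := ht
    refine (mul_le_mul_right (hf t ht.le) _).trans ?_
    rw [← ENNReal.ofReal_mul (by positivity), ← ENNReal.ofReal_mul (by positivity)]
    refine ENNReal.ofReal_le_ofReal ?_
    have h1 : t ^ q ≤ q ^ q * Real.exp (t / T) * T ^ q := by
      calc t ^ q = (t / T) ^ q * T ^ q := by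
            rw [← Real.mul_rpow (by positivity) hT0.le, div_mul_cancel₀ _ hT0.ne']
        _ ≤ _ := by gcongr; exact rpow_le_mul_exp hq (by positivity)
    have h2 : 1 ≤ Real.exp (t / T) * T ^ q := by
      calc (1 : ℝ) = 1 * 1 := by ring
        _ ≤ _ := by
          gcongr
          · exact Real.one_le_exp (by positivity)
          · exact Real.one_le_rpow hT hq.le
    have h3 : Real.exp (-(2 * t) / T) * Real.exp (t / T) = Real.exp (-t / T) := by
      rw [← Real.exp_add]
      congr 1
      ring
    calc _ ≤ Real.exp (-(2 * t) / T) * (C * (Real.exp (t / T) * T ^ q +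
          q ^ q * Real.exp (t / T) * T ^ q)) := by gcongr
      _ = C * (1 + q ^ q) * T ^ q * (Real.exp (-(2 * t) / T) * Real.exp (t / T)) := by ring
      _ = _ := by rw [h3]
  refine (mul_le_mul_right hup (ENNReal.ofReal (2 / T))).trans (le_of_eq ?_)
  rw [← ENNReal.ofReal_mul (by positivity), ← ENNReal.ofReal_mul (by positivity)]
  congr 1
  field_simp

/-! ### Abel means of Cesàro means. -/

/-- The Abel weight is at least `e^{-2}` on `(0, T]`. -/
theorem cesaroMean_le_abelMean (f : ℝ → ℝ≥0∞) {T : ℝ} (hT : 0 < T) :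
    cesaroMean f T ≤ ENNReal.ofReal (Real.exp 2 / 2) * abelMean f T := by
  have h : ∫⁻ t in Set.Ioc (0 : ℝ) T, f t ≤ ENNReal.ofReal (Real.exp 2) *
      ∫⁻ t in Set.Ioi (0 : ℝ), ENNReal.ofReal (Real.exp (-(2 * t) / T)) * f t := by
    rw [← lintegral_const_mul' _ _ ENNReal.ofReal_ne_top]
    refine le_trans (setLIntegral_mono' measurableSet_Ioc fun t ht => ?_)
      (lintegral_mono_set Set.Ioc_subset_Ioi_self)
    rw [← mul_assoc, ← ENNReal.ofReal_mul (by positivity), ← Real.exp_add]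
    refine le_mul_of_one_le_left' ?_
    rw [← ENNReal.ofReal_one]
    refine ENNReal.ofReal_le_ofReal (Real.one_le_exp ?_)
    have : t / T ≤ 1 := (div_le_one hT).2 ht.2
    rw [neg_div, mul_div_assoc]
    linarith
  rw [abelMean, ← mul_assoc, ← ENNReal.ofReal_mul (by positivity)]
  refine (mul_le_mul_right h _).trans (le_of_eq ?_)
  rw [← mul_assoc, ← ENNReal.ofReal_mul (by positivity)]
  congr 2
  field_simp

theorem LocallyBounded.cesaroMean {f : ℝ → ℝ≥0∞} (hf : LocallyBounded f) :
    LocallyBounded (cesaroMean f) := by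
  intro T
  obtain ⟨C, hC⟩ := hf T
  refine ⟨C, fun t ht => ?_⟩
  have h : ∫⁻ s in Set.Ioc (0 : ℝ) t, f s ≤ C * ENNReal.ofReal (t - 0) := by
    rw [← Real.volume_Ioc, ← setLIntegral_const]
    exact setLIntegral_mono' measurableSet_Ioc fun s hs => hC s ⟨hs.1.le, hs.2.trans ht.2⟩
  refine (mul_le_mul_right h _).trans ?_
  rw [mul_left_comm, ← ENNReal.ofReal_mul (by have := ht.1; positivity), sub_zero]
  refine mul_le_of_le_one_right' ?_
  rw [← ENNReal.ofReal_one]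
  refine ENNReal.ofReal_le_ofReal ?_
  rw [one_div]
  -- This covers `t = 0` too, where the product is `0`.
  exact inv_mul_le_one

theorem UpperGrowth.cesaroMean_of_abelMean {q : ℝ} {f : ℝ → ℝ≥0∞}
    (hf : UpperGrowth q (BallisticTransport.abelMean f)) : UpperGrowth q (BallisticTransport.cesaroMean f) := by
  obtain ⟨C, hC, hf⟩ := hf
  refine ⟨Real.exp 2 / 2 * C, by positivity, ?_⟩
  filter_upwards [hf, eventually_gt_atTop 0] with T hT hT0
  refine (cesaroMean_le_abelMean f hT0).trans ((mul_le_mul_right hT _).trans (le_of_eq ?_))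
  rw [← ENNReal.ofReal_mul (by positivity), mul_assoc]

/-- `∫_s^∞ e^{-2t/T} dt/t ≥ e^{-1} e^{-4s/T}`. -/
theorem le_lintegral_exp_mul_inv {T s : ℝ} (hT : 0 < T) (hs : 0 < s) :
    ENNReal.ofReal (Real.exp (-1) * Real.exp (-(2 * s) / (T / 2))) ≤
      ∫⁻ t in Set.Ioi s, ENNReal.ofReal (Real.exp (-(2 * t) / T)) * ENNReal.ofReal (1 / t) := by
  have hd : 0 < s + T / 2 := by positivity
  -- Only `(s, s + T/2]` is kept, with the decreasing integrand replaced by its value at the right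
  -- end. The resulting factor `1 / (1 + 2s/T)` is at least `e^{-2s/T}`, which doubles the rate in
  -- the exponent.
  calc _ ≤ ENNReal.ofReal (Real.exp (-(2 * (s + T / 2)) / T) * (1 / (s + T / 2))) *
        ENNReal.ofReal (s + T / 2 - s) := by
        rw [← ENNReal.ofReal_mul (by positivity)]
        refine ENNReal.ofReal_le_ofReal ?_
        have h1 : 2 * s / T + 1 ≤ Real.exp (2 * s / T) := Real.add_one_le_exp _
        have h2 : Real.exp (-1) * Real.exp (-(2 * s) / (T / 2)) * Real.exp (2 * s / T) =
            Real.exp (-(2 * (s + T / 2)) / T) := by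
          rw [← Real.exp_add, ← Real.exp_add]
          congr 1
          field_simp
          ring
        have h3 : 1 / (s + T / 2) * (s + T / 2 - s) = 1 / (2 * s / T + 1) := by
          field_simp
          ring
        rw [mul_assoc _ (1 / _), h3, mul_one_div, le_div_iff₀ (by positivity), ← h2]
        gcongr
    _ = ∫⁻ _ in Set.Ioc s (s + T / 2),
        ENNReal.ofReal (Real.exp (-(2 * (s + T / 2)) / T) * (1 / (s + T / 2))) := by
        rw [setLIntegral_const, Real.volume_Ioc]
    _ ≤ ∫⁻ t in Set.Ioc s (s + T / 2),
        ENNReal.ofReal (Real.exp (-(2 * t) / T)) * ENNReal.ofReal (1 / t) := by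
        refine setLIntegral_mono' measurableSet_Ioc fun t ht => ?_
        have ht0 : 0 < t := hs.trans ht.1
        have := ht.2
        rw [← ENNReal.ofReal_mul (by positivity)]
        refine ENNReal.ofReal_le_ofReal ?_
        gcongr
    _ ≤ _ := lintegral_mono_set Set.Ioc_subset_Ioi_self

theorem abelMean_mono {f g : ℝ → ℝ≥0∞} {T : ℝ} (h : ∀ t, 0 < t → f t ≤ g t) :
    abelMean f T ≤ abelMean g T :=
  mul_le_mul_right (setLIntegral_mono' measurableSet_Ioi fun t ht => mul_le_mul_right (h t ht) _) _

/-- After Tonelli, `f(s)` is weighted by `∫_s^∞ e^{-2t/T} dt/t`, which dominates `e^{-1}` times the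
Abel kernel at time `T/2`. The factor `1/2` corrects the prefactor `4/T` to `2/T`. Measurability is
needed only for the exchange of integrals. -/
theorem abelMean_le_abelMean_cesaroMean_of_measurable {f : ℝ → ℝ≥0∞} (hf : Measurable f) {T : ℝ}
    (hT : 0 < T) : ENNReal.ofReal (Real.exp (-1) / 2) * abelMean f (T / 2) ≤
      abelMean (cesaroMean f) T := by
  have key : ENNReal.ofReal (Real.exp (-1)) *
      ∫⁻ s in Set.Ioi (0 : ℝ), ENNReal.ofReal (Real.exp (-(2 * s) / (T / 2))) * f s ≤
      ∫⁻ t in Set.Ioi (0 : ℝ), ENNReal.ofReal (Real.exp (-(2 * t) / T)) * cesaroMean f t := by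
    calc _ = ∫⁻ s in Set.Ioi (0 : ℝ),
            ENNReal.ofReal (Real.exp (-1) * Real.exp (-(2 * s) / (T / 2))) * f s := by
          rw [← lintegral_const_mul' _ _ ENNReal.ofReal_ne_top]
          simp_rw [ENNReal.ofReal_mul (Real.exp_pos _).le, mul_assoc]
      _ ≤ ∫⁻ s in Set.Ioi (0 : ℝ), ∫⁻ t in Set.Ioi (0 : ℝ),
            (Set.Ioi s).indicator (fun t => ENNReal.ofReal (Real.exp (-(2 * t) / T)) *
              ENNReal.ofReal (1 / t)) t * f s := by
          refine setLIntegral_mono' measurableSet_Ioi fun s hs => ?_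
          have hs : 0 < s := hs
          rw [lintegral_mul_const _ (Measurable.indicator (by fun_prop) measurableSet_Ioi),
            lintegral_indicator measurableSet_Ioi, Measure.restrict_restrict measurableSet_Ioi,
            Set.inter_eq_left.2 (Set.Ioi_subset_Ioi hs.le)]
          exact mul_le_mul_left (le_lintegral_exp_mul_inv hT hs) _
      _ = ∫⁻ t in Set.Ioi (0 : ℝ), ∫⁻ s in Set.Ioi (0 : ℝ),
            (Set.Ioi s).indicator (fun t => ENNReal.ofReal (Real.exp (-(2 * t) / T)) *
              ENNReal.ofReal (1 / t)) t * f s := by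
          refine lintegral_lintegral_swap (Measurable.aemeasurable ?_)
          refine Measurable.mul ?_ (hf.comp measurable_fst)
          have : (fun z : ℝ × ℝ => (Set.Ioi z.1).indicator
              (fun t => ENNReal.ofReal (Real.exp (-(2 * t) / T)) * ENNReal.ofReal (1 / t)) z.2) =
              {z : ℝ × ℝ | z.1 < z.2}.indicator fun z =>
                ENNReal.ofReal (Real.exp (-(2 * z.2) / T)) * ENNReal.ofReal (1 / z.2) := by
            ext z
            simp [Set.indicator_apply]
          rw [this]
          exact Measurable.indicator (by fun_prop) (measurableSet_lt measurable_fst measurable_snd)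
      _ ≤ _ := by
          refine setLIntegral_mono' measurableSet_Ioi fun t ht => ?_
          rw [cesaroMean, ← mul_assoc, ← lintegral_const_mul' _ _ (by finiteness),
            ← lintegral_indicator measurableSet_Ioc, ← lintegral_indicator measurableSet_Ioi]
          refine lintegral_mono fun s => ?_
          simp only [Set.indicator_apply, Set.mem_Ioi, Set.mem_Ioc]
          -- The left side carries `s < t`, the right side `s ≤ t`; only an inequality is needed.
          split_ifs with h1 h2 h3 h3 <;> simp_all [le_of_lt]
  rw [abelMean, abelMean, ← mul_assoc, ← ENNReal.ofReal_mul (by positivity)]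
  refine le_trans (le_of_eq ?_) (mul_le_mul_right key _)
  rw [← mul_assoc, ← ENNReal.ofReal_mul (by positivity)]
  congr 2
  field_simp

/-- Measurability is removed by a measurable minorant of the weighted function with the same lower
integral. Dividing by the weight gives a measurable function below `f` with the same Abel mean at
`T/2`, and the right side is monotone in `f`. -/
theorem abelMean_le_abelMean_cesaroMean (f : ℝ → ℝ≥0∞) {T : ℝ} (hT : 0 < T) :
    ENNReal.ofReal (Real.exp (-1) / 2) * abelMean f (T / 2) ≤ abelMean (cesaroMean f) T := by
  set w : ℝ → ℝ≥0∞ := fun s => ENNReal.ofReal (Real.exp (-(2 * s) / (T / 2))) with hw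
  have hw0 : ∀ s, w s ≠ 0 := fun s => by simp [hw, Real.exp_pos]
  have hwt : ∀ s, w s ≠ ∞ := fun s => ENNReal.ofReal_ne_top
  have hwm : Measurable w := by fun_prop
  obtain ⟨g, hg, hgf, hgi⟩ := exists_measurable_le_lintegral_eq
    (volume.restrict (Set.Ioi (0 : ℝ))) fun s => w s * f s
  have hle : ∀ s, (w s)⁻¹ * g s ≤ f s := fun s => by
    refine (mul_le_mul_right (hgf s) _).trans (le_of_eq ?_)
    rw [← mul_assoc, ENNReal.inv_mul_cancel (hw0 s) (hwt s), one_mul]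
  have heq : abelMean f (T / 2) = abelMean (fun s => (w s)⁻¹ * g s) (T / 2) := by
    rw [abelMean, abelMean, hgi]
    congr 2
    ext s
    rw [← mul_assoc]
    change g s = w s * (w s)⁻¹ * g s
    rw [ENNReal.mul_inv_cancel (hw0 s) (hwt s), one_mul]
  rw [heq]
  refine (abelMean_le_abelMean_cesaroMean_of_measurable (hwm.inv.mul hg) hT).trans
    (abelMean_mono fun t _ => mul_le_mul_right (lintegral_mono hle) _)

theorem LowerGrowth.abelMean_cesaroMean {q : ℝ} {f : ℝ → ℝ≥0∞}
    (hf : LowerGrowth q (BallisticTransport.abelMean f)) :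
    LowerGrowth q (BallisticTransport.abelMean (BallisticTransport.cesaroMean f)) := by
  obtain ⟨c, hc, hf⟩ := hf
  refine ⟨Real.exp (-1) / 2 * (c * (1 / 2) ^ q), by positivity, ?_⟩
  filter_upwards [(tendsto_id.atTop_div_const (two_pos : (0 : ℝ) < 2)).eventually hf,
    eventually_gt_atTop 0] with T hT hT0
  refine le_trans ?_ (abelMean_le_abelMean_cesaroMean f hT0)
  refine le_trans (le_of_eq ?_) (mul_le_mul_right hT _)
  rw [← ENNReal.ofReal_mul (by positivity), id, div_eq_mul_one_div T 2,
    Real.mul_rpow hT0.le (by norm_num)]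
  congr 1
  ring

/-- The Abel bound yields a pointwise bound on the Cesàro mean, which is then averaged again. -/
theorem UpperGrowth.abelMean_cesaroMean {q : ℝ} (hq : 0 < q) {f : ℝ → ℝ≥0∞}
    (hb : LocallyBounded f) (hf : UpperGrowth q (BallisticTransport.abelMean f)) :
    UpperGrowth q (BallisticTransport.abelMean (BallisticTransport.cesaroMean f)) :=
  hf.cesaroMean_of_abelMean.abelMean hq hb.cesaroMean

section Means

variable {p : ℝ} {f : ℝ → ℝ≥0∞}

theorem NormGrowth.abelMean (hp : 0 < p) (hb : LocallyBounded f) (h : NormGrowth p f) :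
    NormGrowth p (abelMean f) :=
  normGrowth_iff.2 ⟨(normGrowth_iff.1 h).1.abelMean hp, (normGrowth_iff.1 h).2.abelMean hp hb⟩

theorem NormGrowth.cesaroMean (hp : 0 < p) (hb : LocallyBounded f) (h : NormGrowth p f) :
    NormGrowth p (cesaroMean f) :=
  normGrowth_iff.2 ⟨(normGrowth_iff.1 h).1.cesaroMean hp, (normGrowth_iff.1 h).2.cesaroMean hp hb⟩

theorem NormGrowth.abelMean_cesaroMean (hp : 0 < p) (hb : LocallyBounded f)
    (h : NormGrowth p (BallisticTransport.abelMean f)) :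
    NormGrowth p (BallisticTransport.abelMean (BallisticTransport.cesaroMean f)) :=
  normGrowth_iff.2 ⟨(normGrowth_iff.1 h).1.abelMean_cesaroMean,
    (normGrowth_iff.1 h).2.abelMean_cesaroMean hp hb⟩

theorem ExponentsEqOne.abelMean (hp : 0 < p) (hb : LocallyBounded f) (h : ExponentsEqOne p f) :
    ExponentsEqOne p (abelMean f) :=
  (exponentsEqOne_iff hp).2 ⟨fun q hq hqp => (((exponentsEqOne_iff hp).1 h).1 q hq hqp).abelMean hq,
    fun q hq => (((exponentsEqOne_iff hp).1 h).2 q hq).abelMean (hp.trans hq) hb⟩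

theorem ExponentsEqOne.cesaroMean (hp : 0 < p) (hb : LocallyBounded f) (h : ExponentsEqOne p f) :
    ExponentsEqOne p (cesaroMean f) :=
  (exponentsEqOne_iff hp).2
    ⟨fun q hq hqp => (((exponentsEqOne_iff hp).1 h).1 q hq hqp).cesaroMean hq,
      fun q hq => (((exponentsEqOne_iff hp).1 h).2 q hq).cesaroMean (hp.trans hq) hb⟩

theorem ExponentsEqOne.abelMean_cesaroMean (hp : 0 < p) (hb : LocallyBounded f)
    (h : ExponentsEqOne p (BallisticTransport.abelMean f)) :
    ExponentsEqOne p (BallisticTransport.abelMean (BallisticTransport.cesaroMean f)) :=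
  (exponentsEqOne_iff hp).2
    ⟨fun q hq hqp => (((exponentsEqOne_iff hp).1 h).1 q hq hqp).abelMean_cesaroMean,
      fun q hq => (((exponentsEqOne_iff hp).1 h).2 q hq).abelMean_cesaroMean (hp.trans hq) hb⟩

end Means

end Growth

/-! ### Cesàro means of vector-valued curves. -/

/-- If `g(t) / t^r → P`, then the Cesàro averages of `g` satisfy `⟨g⟩(T) / T^r → P / (r + 1)`. -/
theorem tendsto_cesaro_of_tendsto {E : Type*} [NormedAddCommGroup E] [NormedSpace ℝ E]
    [CompleteSpace E] {r : ℝ} (hr : 0 < r) {g : ℝ → E} {P : E}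
    (hg : ∀ T : ℝ, 0 < T → IntervalIntegrable g volume 0 T)
    (h : Tendsto (fun t : ℝ => ((t ^ r)⁻¹ : ℝ) • g t) atTop (𝓝 P)) :
    Tendsto (fun T : ℝ => ((T ^ r)⁻¹ : ℝ) • (T⁻¹ : ℝ) • ∫ t in (0 : ℝ)..T, g t) atTop
      (𝓝 ((r + 1)⁻¹ • P)) := by
  have hpow : ∀ a b : ℝ, IntervalIntegrable (fun t : ℝ => t ^ r • P) volume a b := fun a b =>
    (Continuous.smul (Real.continuous_rpow_const hr.le) continuous_const).intervalIntegrable a b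
  refine Metric.tendsto_nhds.2 fun ε hε => ?_
  obtain ⟨T₀, hT₀1, hT₀⟩ : ∃ T₀ : ℝ, 1 ≤ T₀ ∧ ∀ t, T₀ ≤ t →
      ‖g t - t ^ r • P‖ ≤ ε / 2 * t ^ r := by
    obtain ⟨T₁, hT₁⟩ := eventually_atTop.1 (Metric.tendsto_nhds.1 h (ε / 2) (by positivity))
    refine ⟨max T₁ 1, le_max_right _ _, fun t ht => ?_⟩
    have ht0 : 0 < t := one_pos.trans_le ((le_max_right _ _).trans ht)
    have h1 := (hT₁ t ((le_max_left _ _).trans ht)).le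
    have h2 : g t - t ^ r • P = t ^ r • ((t ^ r)⁻¹ • g t - P) := by
      rw [smul_sub, smul_inv_smul₀ (by positivity)]
    rw [h2, norm_smul, Real.norm_of_nonneg (by positivity), mul_comm]
    rw [dist_eq_norm] at h1
    gcongr
  have hT₀0 : 0 < T₀ := by linarith
  -- The error before `T₀` is a fixed constant, killed by `T^{-r-1}`; the error after `T₀`
  -- contributes at most `ε/2`.
  set K : ℝ := ‖∫ t in (0 : ℝ)..T₀, (g t - t ^ r • P)‖
  have hK : Tendsto (fun T : ℝ => (T ^ r)⁻¹ * (T⁻¹ * K)) atTop (𝓝 0) := by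
    simpa using (tendsto_rpow_atTop hr).inv_tendsto_atTop.mul
      (tendsto_inv_atTop_zero.mul_const K)
  filter_upwards [hK.eventually (gt_mem_nhds (half_pos hε)), eventually_ge_atTop T₀] with T hT hTT
  have hT0 : 0 < T := by linarith
  have hTr : (T ^ r) ≠ 0 := by positivity
  have hsplit : ∫ t in (0 : ℝ)..T, (g t - t ^ r • P) =
      (∫ t in (0 : ℝ)..T, g t) - (T ^ (r + 1) / (r + 1)) • P := by
    rw [intervalIntegral.integral_sub (hg T hT0) (hpow 0 T), intervalIntegral.integral_smul_const,
      integral_rpow (Or.inl (by linarith)), Real.zero_rpow (by positivity), sub_zero]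
  have hdiff : (T ^ r)⁻¹ • T⁻¹ • (∫ t in (0 : ℝ)..T, g t) - (r + 1)⁻¹ • P =
      (T ^ r)⁻¹ • T⁻¹ • ∫ t in (0 : ℝ)..T, (g t - t ^ r • P) := by
    rw [hsplit, smul_sub, smul_sub, smul_smul T⁻¹ (_ / _), smul_smul _ (_ * _) P]
    congr 2
    rw [Real.rpow_add_one hT0.ne']
    field_simp
  have hint : ∀ a b : ℝ, 0 < a → 0 < b →
      IntervalIntegrable (fun t => g t - t ^ r • P) volume a b := fun a b ha hb =>
    ((hg a ha).symm.trans (hg b hb)).sub (hpow a b)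
  have htail : ‖∫ t in T₀..T, (g t - t ^ r • P)‖ ≤ ε / 2 * T ^ r * T := by
    refine (intervalIntegral.norm_integral_le_of_norm_le_const (C := ε / 2 * T ^ r)
      fun t ht => ?_).trans ?_
    · rw [Set.uIoc_of_le hTT] at ht
      refine (hT₀ t ht.1.le).trans ?_
      have := ht.2
      have : 0 < t := hT₀0.trans ht.1
      gcongr
    · rw [abs_of_nonneg (by linarith)]
      gcongr
      linarith
  have hnorm : ‖∫ t in (0 : ℝ)..T, (g t - t ^ r • P)‖ ≤ K + ε / 2 * T ^ r * T := by
    rw [← intervalIntegral.integral_add_adjacent_intervals ((hg T₀ hT₀0).sub (hpow 0 T₀))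
      (hint T₀ T hT₀0 hT0)]
    exact (norm_add_le _ _).trans (by gcongr)
  rw [dist_eq_norm, hdiff, norm_smul, norm_smul, Real.norm_of_nonneg (by positivity),
    Real.norm_of_nonneg (by positivity)]
  calc (T ^ r)⁻¹ * (T⁻¹ * _) ≤ (T ^ r)⁻¹ * (T⁻¹ * (K + ε / 2 * T ^ r * T)) := by gcongr
    _ = (T ^ r)⁻¹ * (T⁻¹ * K) + ε / 2 := by field_simp
    _ < ε := by linarith

/-! ### Propagators and resolvents in an abstract Hilbert space. -/

section Abstract

variable {E : Type*} [NormedAddCommGroup E] [InnerProductSpace ℂ E]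

theorem continuous_propagator (H : E →ₗ.[ℂ] E) (ψ : E) : Continuous fun t => propagator H t ψ := by
  by_cases h : ∃ U : ℝ → E ≃ₗᵢ[ℂ] E, IsUnitaryGroupOf H U
  · rw [propagator, dif_pos h]
    exact h.choose_spec.continuous ψ
  · rw [propagator, dif_neg h]
    exact continuous_const

/-- Applying the isometry at time `t` to the difference leaves only the forward propagator acting on
a fixed vector, so strong continuity suffices and the group law is not needed. -/
theorem continuous_propagator_symm (H : E →ₗ.[ℂ] E) {χ : ℝ → E} (hχ : Continuous χ) :
    Continuous fun t => (propagator H t).symm (χ t) := by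
  refine continuous_iff_continuousAt.2 fun s => tendsto_iff_norm_sub_tendsto_zero.2 ?_
  have h : ∀ t, ‖(propagator H t).symm (χ t) - (propagator H s).symm (χ s)‖ =
      ‖χ t - propagator H t ((propagator H s).symm (χ s))‖ := fun t => by
    rw [← (propagator H t).norm_map ((propagator H t).symm (χ t) - _), map_sub,
      LinearIsometryEquiv.apply_symm_apply]
  simp_rw [h]
  have h2 := ((hχ.sub (continuous_propagator H ((propagator H s).symm (χ s)))).norm.tendsto s)
  simpa using h2

theorem evalOrZero_of_mem {A : E →ₗ.[ℂ] E} {ψ : E} (h : ψ ∈ A.domain) :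
    evalOrZero A ψ = A ⟨ψ, h⟩ := dif_pos h

theorem evalOrZero_heisenberg {H A : E →ₗ.[ℂ] E} {t : ℝ} {ψ : E}
    (h : propagator H t ψ ∈ A.domain) :
    evalOrZero (heisenberg H A t) ψ = (propagator H t).symm (A ⟨propagator H t ψ, h⟩) :=
  evalOrZero_of_mem (A := heisenberg H A t) h

/-- Symmetry makes `⟨Pη, η⟩` real, so the cross term vanishes. -/
theorem norm_sq_sub_I_smul {P : E →ₗ.[ℂ] E} (hP : P.IsFormalAdjoint P) (η : P.domain) :
    ‖P η - Complex.I • (η : E)‖ ^ 2 = ‖P η‖ ^ 2 + ‖(η : E)‖ ^ 2 := by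
  have h : (inner ℂ (P η) (η : E)).im = 0 := by
    rw [← Complex.conj_eq_iff_im, inner_conj_symm]
    exact (hP η η).symm
  rw [@norm_sub_sq ℂ, inner_smul_right]
  simp [norm_smul, h]

/-- With `φ = Pη - iη`, the norms of `φ` and `η` agree only if `Pη = 0`, and then `φ = -iη` lies in
the kernel. -/
theorem norm_resolventAt_I_lt {P : E →ₗ.[ℂ] E} (hP : P.IsFormalAdjoint P) {φ : E}
    (hφ : ¬ InKernel P φ) : ‖resolventAt P Complex.I φ‖ < ‖φ‖ := by
  have hφ0 : φ ≠ 0 := by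
    rintro rfl
    exact hφ ⟨P.domain.zero_mem, P.map_zero⟩
  rw [resolventAt]
  split_ifs with h
  · have heq := h.choose_spec
    set η := h.choose
    have hnorm := norm_sq_sub_I_smul hP η
    rw [heq] at hnorm
    have hne : P η ≠ 0 := by
      intro h0
      rw [h0, zero_sub, ← neg_smul] at heq
      refine hφ ⟨heq ▸ P.domain.smul_mem _ η.2, ?_⟩
      have : (⟨φ, heq ▸ P.domain.smul_mem _ η.2⟩ : P.domain) = (-Complex.I) • η :=
        Subtype.ext heq.symm
      rw [this, P.map_smul, h0, smul_zero]
    have := norm_pos_iff.2 hne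
    exact lt_of_pow_lt_pow_left₀ 2 (norm_nonneg _) (by nlinarith)
  -- Without a solution `resolventAt` is `0`, and `φ ≠ 0`.
  · simpa using hφ0

end Abstract

/-! ### Multiplication operators and their truncations. -/

section Multiplication

variable {d : ℕ} {μ : Measure (EuclideanSpace ℝ (Fin d))}

theorem enorm_sq_eq_lintegral (φ : StateSpace μ) : ‖φ‖ₑ ^ 2 = ∫⁻ x, ‖φ x‖ₑ ^ 2 ∂μ := by
  rw [Lp.enorm_def, eLpNorm_eq_lintegral_rpow_enorm_toReal (by norm_num) (by norm_num)]
  simp only [ENNReal.toReal_ofNat, ENNReal.rpow_ofNat, one_div]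
  rw [← ENNReal.rpow_natCast, ← ENNReal.rpow_mul]
  simp

theorem mulOperator_ae_eq {f : EuclideanSpace ℝ (Fin d) → ℝ} {ψ : StateSpace μ}
    (h : ψ ∈ (mulOperator f : StateSpace μ →ₗ.[ℂ] StateSpace μ).domain) :
    (mulOperator f ⟨ψ, h⟩ : StateSpace μ) =ᵐ[μ] fun x => (f x : ℂ) * ψ x :=
  MemLp.coeFn_toLp h

theorem enorm_sq_mulOperator {f : EuclideanSpace ℝ (Fin d) → ℝ} {ψ : StateSpace μ}
    (h : ψ ∈ (mulOperator f : StateSpace μ →ₗ.[ℂ] StateSpace μ).domain) :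
    ‖(mulOperator f ⟨ψ, h⟩ : StateSpace μ)‖ₑ ^ 2 = ∫⁻ x, ‖f x‖ₑ ^ 2 * ‖ψ x‖ₑ ^ 2 ∂μ := by
  rw [enorm_sq_eq_lintegral]
  refine lintegral_congr_ae ?_
  filter_upwards [mulOperator_ae_eq h] with x hx
  rw [hx, enorm_mul, mul_pow]
  congr 2
  simp [← ofReal_norm]

theorem mem_domain_mulOperator {f : EuclideanSpace ℝ (Fin d) → ℝ} (hf : Measurable f)
    {ψ : StateSpace μ} (h : ∫⁻ x, ‖f x‖ₑ ^ 2 * ‖ψ x‖ₑ ^ 2 ∂μ < ∞) :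
    ψ ∈ (mulOperator f : StateSpace μ →ₗ.[ℂ] StateSpace μ).domain := by
  refine ⟨(by fun_prop : Measurable fun x => (f x : ℂ)).aestronglyMeasurable.mul
    (Lp.aestronglyMeasurable ψ), ?_⟩
  rw [eLpNorm_lt_top_iff_lintegral_rpow_enorm_lt_top (by norm_num) (by norm_num)]
  refine lt_of_le_of_lt (le_of_eq (lintegral_congr fun x => ?_)) h
  rw [enorm_mul, ENNReal.toReal_ofNat, ENNReal.rpow_ofNat, mul_pow]
  congr 2
  simp [← ofReal_norm]

theorem mem_domain_mulOperator_of_bounded {f : EuclideanSpace ℝ (Fin d) → ℝ} (hf : Measurable f)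
    {C : ℝ} (hC : ∀ x, |f x| ≤ C) (ψ : StateSpace μ) :
    ψ ∈ (mulOperator f : StateSpace μ →ₗ.[ℂ] StateSpace μ).domain :=
  (Lp.memLp ψ).of_le_mul (c := C)
    ((by fun_prop : Measurable fun x => (f x : ℂ)).aestronglyMeasurable.mul
      (Lp.aestronglyMeasurable ψ))
    (ae_of_all _ fun x => by
      rw [norm_mul, Complex.norm_real]
      exact mul_le_mul_of_nonneg_right (hC x) (norm_nonneg _))

/-- Multiplication by a bounded measurable function. -/
noncomputable def boundedMul (f : EuclideanSpace ℝ (Fin d) → ℝ) (hf : Measurable f) (C : ℝ)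
    (hC : ∀ x, |f x| ≤ C) : StateSpace μ →L[ℂ] StateSpace μ :=
  LinearMap.mkContinuous
    { toFun := fun ψ => mulOperator f ⟨ψ, mem_domain_mulOperator_of_bounded hf hC ψ⟩
      map_add' := fun ψ φ => (mulOperator f).map_add
        ⟨ψ, mem_domain_mulOperator_of_bounded hf hC ψ⟩
        ⟨φ, mem_domain_mulOperator_of_bounded hf hC φ⟩
      map_smul' := fun c ψ => (mulOperator f).map_smul c
        ⟨ψ, mem_domain_mulOperator_of_bounded hf hC ψ⟩ } C fun ψ => by
    refine Lp.norm_le_mul_norm_of_ae_le_mul ?_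
    filter_upwards [mulOperator_ae_eq (mem_domain_mulOperator_of_bounded hf hC ψ)] with x hx
    change ‖(mulOperator f ⟨ψ, mem_domain_mulOperator_of_bounded hf hC ψ⟩ : StateSpace μ) x‖ ≤ _
    rw [hx, norm_mul, Complex.norm_real]
    exact mul_le_mul_of_nonneg_right (hC x) (norm_nonneg _)

theorem boundedMul_ae_eq {f : EuclideanSpace ℝ (Fin d) → ℝ} (hf : Measurable f) {C : ℝ}
    (hC : ∀ x, |f x| ≤ C) (ψ : StateSpace μ) :
    boundedMul f hf C hC ψ =ᵐ[μ] fun x => (f x : ℂ) * ψ x :=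
  mulOperator_ae_eq (mem_domain_mulOperator_of_bounded hf hC ψ)

/-- The truncation of `f` to the set where `|f| ≤ n`. -/
noncomputable def truncation (f : EuclideanSpace ℝ (Fin d) → ℝ) (n : ℕ) :
    EuclideanSpace ℝ (Fin d) → ℝ := {x | |f x| ≤ n}.indicator f

theorem measurable_truncation {f : EuclideanSpace ℝ (Fin d) → ℝ} (hf : Measurable f) (n : ℕ) :
    Measurable (truncation f n) :=
  hf.indicator (measurableSet_le (by fun_prop) measurable_const)

theorem abs_truncation_le (f : EuclideanSpace ℝ (Fin d) → ℝ) (n : ℕ)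
    (x : EuclideanSpace ℝ (Fin d)) : |truncation f n x| ≤ n := by
  by_cases h : |f x| ≤ n <;> simp [truncation, h]

/-- Dominated convergence: the difference is bounded pointwise by `|f ψ|` and vanishes at each point
once `n ≥ |f x|`. -/
theorem tendsto_boundedMul_truncation {f : EuclideanSpace ℝ (Fin d) → ℝ} (hf : Measurable f)
    {ψ : StateSpace μ} (h : ψ ∈ (mulOperator f : StateSpace μ →ₗ.[ℂ] StateSpace μ).domain) :
    Tendsto (fun n : ℕ =>
      boundedMul (truncation f n) (measurable_truncation hf n) n (abs_truncation_le f n) ψ)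
      atTop (𝓝 (mulOperator f ⟨ψ, h⟩)) := by
  set F : ℕ → StateSpace μ := fun n =>
    boundedMul (truncation f n) (measurable_truncation hf n) n (abs_truncation_le f n) ψ
  set G : StateSpace μ := mulOperator f ⟨ψ, h⟩
  have hsub : ∀ n, (F n - G : StateSpace μ) =ᵐ[μ]
      fun x => ((truncation f n x : ℂ) - f x) * ψ x := fun n => by
    filter_upwards [Lp.coeFn_sub (F n) G, mulOperator_ae_eq h,
      boundedMul_ae_eq (measurable_truncation hf n) (abs_truncation_le f n) ψ] with x h1 h2 h3
    rw [h1, Pi.sub_apply, h2, h3, sub_mul]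
  have hlim : Tendsto (fun n => ‖F n - G‖ₑ ^ 2) atTop (𝓝 0) := by
    have h0 : (0 : ℝ≥0∞) = ∫⁻ _, 0 ∂μ := by simp
    simp_rw [enorm_sq_eq_lintegral]
    rw [h0]
    refine tendsto_lintegral_of_dominated_convergence' (fun x => ‖G x‖ₑ ^ 2)
      (fun n => (Lp.aestronglyMeasurable (F n - G)).enorm.pow_const 2) ?_ ?_ ?_
    · intro n
      filter_upwards [hsub n, mulOperator_ae_eq h] with x h1 h2
      rw [h1, h2]
      gcongr ?_ ^ 2
      rw [enorm_mul, enorm_mul]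
      gcongr
      by_cases hx : |f x| ≤ n <;> simp [truncation, hx]
    · rw [← enorm_sq_eq_lintegral]
      finiteness
    · filter_upwards [ae_all_iff.2 hsub] with x hx
      refine tendsto_const_nhds.congr' ?_
      filter_upwards [tendsto_natCast_atTop_atTop.eventually_ge_atTop |f x|] with n hn
      rw [hx n]
      simp [truncation, hn]
  refine tendsto_iff_edist_tendsto_0.2 ?_
  have := (ENNReal.continuous_rpow_const (y := (1 / 2 : ℝ))).tendsto _ |>.comp hlim
  simp only [one_div, ENNReal.zero_rpow_of_pos (by norm_num : (0 : ℝ) < 2⁻¹)] at this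
  refine this.congr fun n => ?_
  rw [Function.comp, ← ENNReal.rpow_natCast, ← ENNReal.rpow_mul, edist_eq_enorm_sub]
  simp

end Multiplication

/-! ### Strong transport: norm growth and averages. -/

section Transport

variable {d : ℕ} {μ : Measure (EuclideanSpace ℝ (Fin d))}
  {H : StateSpace μ →ₗ.[ℂ] StateSpace μ}

theorem enorm_sq_evalOrZero_heisenberg {f : EuclideanSpace ℝ (Fin d) → ℝ} {t : ℝ}
    {ψ : StateSpace μ} (h : ψ ∈ (heisenberg H (mulOperator f) t).domain) :
    ‖evalOrZero (heisenberg H (mulOperator f) t) ψ‖ₑ ^ 2 =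
      ∫⁻ x, ‖f x‖ₑ ^ 2 * ‖propagator H t ψ x‖ₑ ^ 2 ∂μ := by
  have h' : propagator H t ψ ∈ (mulOperator f : StateSpace μ →ₗ.[ℂ] StateSpace μ).domain := h
  rw [evalOrZero_heisenberg h', ← enorm_sq_mulOperator h']
  congr 1
  rw [← ofReal_norm, ← ofReal_norm, LinearIsometryEquiv.norm_map]

/-- The curve is a pointwise limit of the curves for the truncations of `f`, which are continuous in
`t` because the truncated operators are bounded. -/
theorem aestronglyMeasurable_evalOrZero_heisenberg {f : EuclideanSpace ℝ (Fin d) → ℝ}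
    (hf : Measurable f) {ψ : StateSpace μ} {s : Set ℝ} (hs : MeasurableSet s)
    (h : ∀ t ∈ s, ψ ∈ (heisenberg H (mulOperator f) t).domain) :
    AEStronglyMeasurable (fun t => evalOrZero (heisenberg H (mulOperator f) t) ψ)
      (volume.restrict s) := by
  refine aestronglyMeasurable_of_tendsto_ae (u := atTop) (f := fun (n : ℕ) t =>
    (propagator H t).symm (boundedMul (truncation f n) (measurable_truncation hf n) n
      (abs_truncation_le f n) (propagator H t ψ))) (fun n => ?_) ?_
  · exact (continuous_propagator_symm H
      ((boundedMul _ _ _ _).continuous.comp (continuous_propagator H ψ))).aestronglyMeasurable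
  · filter_upwards [ae_restrict_mem hs] with t ht
    rw [evalOrZero_heisenberg (h t ht)]
    exact ((propagator H t).symm.continuous.tendsto _).comp
      (tendsto_boundedMul_truncation hf (h t ht))

/-- Strong transport is inherited by the Cesàro averages, if `‖A(t) ψ‖` is locally bounded. -/
theorem StrongTransportFor.averaged {ι : Type} [Finite ι] {f : ι → EuclideanSpace ℝ (Fin d) → ℝ}
    (hf : ∀ j, Measurable (f j)) {r : ℝ} (hr : 0 < r) {ψ : StateSpace μ}
    (hb : ∀ j, LocallyBounded fun t => ∫⁻ x, ‖f j x‖ₑ ^ 2 * ‖propagator H t ψ x‖ₑ ^ 2 ∂μ)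
    (h : StrongTransportFor H (fun j => mulOperator (f j)) r ψ) :
    AveragedStrongTransportFor H (fun j => mulOperator (f j)) r ψ := by
  -- The domain condition for large times is dropped: `hb` gives it for all `t ≥ 0`.
  obtain ⟨P, hP0, -, hP⟩ := h
  have hdom : ∀ j, ∀ t : ℝ, 0 ≤ t → ψ ∈ (heisenberg H (mulOperator (f j)) t).domain := by
    intro j t ht
    obtain ⟨C, hC⟩ := hb j t
    exact mem_domain_mulOperator (hf j) ((hC t ⟨ht, le_rfl⟩).trans_lt ENNReal.coe_lt_top)
  have hint : ∀ j, ∀ T : ℝ, 0 < T →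
      IntervalIntegrable (fun t => evalOrZero (heisenberg H (mulOperator (f j)) t) ψ)
        volume 0 T := by
    intro j T hT
    obtain ⟨C, hC⟩ := hb j T
    rw [intervalIntegrable_iff, Set.uIoc_of_le hT.le]
    refine Integrable.of_bound (aestronglyMeasurable_evalOrZero_heisenberg (hf j)
      measurableSet_Ioc fun t ht => hdom j t ht.1.le) (Real.sqrt C) ?_
    filter_upwards [ae_restrict_mem measurableSet_Ioc] with t ht
    have h1 : ∫⁻ x, ‖f j x‖ₑ ^ 2 * ‖propagator H t ψ x‖ₑ ^ 2 ∂μ ≤ C := hC t ⟨ht.1.le, ht.2⟩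
    rw [← enorm_sq_evalOrZero_heisenberg (hdom j t ht.1.le), ← ofReal_norm,
      ← ENNReal.ofReal_pow (norm_nonneg _), ← ENNReal.ofReal_coe_nnreal,
      ENNReal.ofReal_le_ofReal_iff C.coe_nonneg] at h1
    exact Real.le_sqrt_of_sq_le h1
  refine ⟨fun j => (r + 1)⁻¹ • P j, ?_, fun j => ?_, hint, fun j => ?_⟩
  · obtain ⟨j, hj⟩ := Function.ne_iff.1 hP0
    exact Function.ne_iff.2 ⟨j, smul_ne_zero (by positivity) hj⟩
  · filter_upwards [ae_restrict_mem measurableSet_Ioi] with t ht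
    exact hdom j t (le_of_lt ht)
  · exact tendsto_cesaro_of_tendsto hr (hint j) (hP j)

/-- Strong transport at the rate `t^r` makes `∑_j ‖A_j(t) ψ‖²` grow like `t^{2r}`. -/
theorem StrongTransportFor.normGrowth {E : Type*} [NormedAddCommGroup E] [InnerProductSpace ℂ E]
    {H : E →ₗ.[ℂ] E} {ι : Type} [Fintype ι] {A : ι → E →ₗ.[ℂ] E} {r : ℝ} {ψ : E}
    {M : ℝ → ℝ≥0∞} (h : StrongTransportFor H A r ψ)
    (hM : ∀ t, (∀ j, ψ ∈ (heisenberg H (A j) t).domain) →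
      M t = ∑ j, ‖evalOrZero (heisenberg H (A j) t) ψ‖ₑ ^ 2) :
    NormGrowth (2 * r) M := by
  obtain ⟨P, hP0, hdom, hP⟩ := h
  set L : ℝ := ∑ j, ‖P j‖ ^ 2
  have hL : 0 < L := by
    obtain ⟨j, hj⟩ := Function.ne_iff.1 hP0
    exact Finset.sum_pos' (fun _ _ => by positivity)
      ⟨j, Finset.mem_univ _, by have := norm_pos_iff.2 hj; positivity⟩
  have hlim : Tendsto (fun t : ℝ =>
      ∑ j, ‖((t ^ r)⁻¹ : ℝ) • evalOrZero (heisenberg H (A j) t) ψ‖ ^ 2) atTop (𝓝 L) :=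
    tendsto_finsetSum _ fun j _ => ((hP j).norm.pow 2)
  -- The rescaled sum of squares tends to `L > 0`, hence is eventually between `L/2` and `2L`.
  refine ⟨L / 2, 2 * L, by positivity, by positivity, ?_⟩
  filter_upwards [hlim.eventually (lt_mem_nhds (half_lt_self hL)),
    hlim.eventually (gt_mem_nhds (by linarith : L < 2 * L)), eventually_all.2 hdom,
    eventually_gt_atTop 0] with t h1 h2 h3 ht
  have heq : M t = ENNReal.ofReal
      ((∑ j, ‖((t ^ r)⁻¹ : ℝ) • evalOrZero (heisenberg H (A j) t) ψ‖ ^ 2) * t ^ (2 * r)) := by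
    rw [hM t h3, Finset.sum_mul, ENNReal.ofReal_sum_of_nonneg fun _ _ => by positivity]
    refine Finset.sum_congr rfl fun j _ => ?_
    rw [← ofReal_norm, ← ENNReal.ofReal_pow (norm_nonneg _), norm_smul,
      Real.norm_of_nonneg (by positivity), mul_comm 2 r, Real.rpow_mul ht.le, Real.rpow_two]
    congr 1
    field_simp
  rw [heq]
  exact ⟨ENNReal.ofReal_le_ofReal (by gcongr), ENNReal.ofReal_le_ofReal (by gcongr)⟩

theorem enorm_sq_eq_sum (x : EuclideanSpace ℝ (Fin d)) : ‖x‖ₑ ^ 2 = ∑ j, ‖x j‖ₑ ^ 2 := by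
  simp_rw [← ofReal_norm, ← ENNReal.ofReal_pow (norm_nonneg _)]
  rw [← ENNReal.ofReal_sum_of_nonneg fun _ _ => by positivity, EuclideanSpace.norm_sq_eq]

theorem moment_two_eq_sum (ψ : StateSpace μ) (t : ℝ) :
    moment H 2 ψ t = ∑ j, ∫⁻ x, ‖x j‖ₑ ^ 2 * ‖propagator H t ψ x‖ₑ ^ 2 ∂μ := by
  have hm : ∀ j ∈ Finset.univ, AEMeasurable
      (fun x : EuclideanSpace ℝ (Fin d) => ‖x j‖ₑ ^ 2 * ‖propagator H t ψ x‖ₑ ^ 2) μ := fun j _ =>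
    AEMeasurable.mul
      (by fun_prop : Measurable fun x : EuclideanSpace ℝ (Fin d) => ‖x j‖ₑ ^ 2).aemeasurable
      ((Lp.aestronglyMeasurable (propagator H t ψ)).enorm.pow_const 2)
  rw [← lintegral_finsetSum' _ hm]
  refine lintegral_congr fun x => ?_
  rw [← Finset.sum_mul, ← enorm_sq_eq_sum, ENNReal.rpow_two]

theorem moment_two_mul_eq (p : ℝ) (hp : 0 < p) (ψ : StateSpace μ) (t : ℝ) :
    moment H (2 * p) ψ t = ∫⁻ x, ‖‖x‖ ^ p‖ₑ ^ 2 * ‖propagator H t ψ x‖ₑ ^ 2 ∂μ := by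
  refine lintegral_congr fun x => ?_
  congr 1
  rw [mul_comm 2 p, ENNReal.rpow_mul, ENNReal.rpow_two, Real.enorm_of_nonneg (by positivity),
    ← ENNReal.ofReal_rpow_of_nonneg (norm_nonneg _) hp.le, ofReal_norm]

theorem StrongTransport.normGrowth {ψ : StateSpace μ} (h : StrongTransport H ψ) :
    NormGrowth 2 (moment H 2 ψ) := by
  have := StrongTransportFor.normGrowth (M := moment H 2 ψ) h fun t ht => by
    rw [moment_two_eq_sum]
    exact Finset.sum_congr rfl fun j _ => (enorm_sq_evalOrZero_heisenberg (ht j)).symm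
  rwa [mul_one] at this

theorem StrongMomentTransport.normGrowth {p : ℝ} (hp : 0 < p) {ψ : StateSpace μ}
    (h : StrongMomentTransport H p ψ) : NormGrowth (2 * p) (moment H (2 * p) ψ) :=
  StrongTransportFor.normGrowth h fun t ht => by
    rw [moment_two_mul_eq p hp, Fintype.sum_unique]
    exact (enorm_sq_evalOrZero_heisenberg (ht ())).symm

theorem StrongTransport.averaged {ψ : StateSpace μ} (hb : LocallyBoundedMoment H 2 ψ)
    (h : StrongTransport H ψ) : AveragedStrongTransport H ψ := by
  refine StrongTransportFor.averaged (fun j => by fun_prop) one_pos (fun j T => ?_) h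
  obtain ⟨C, hC⟩ := hb T
  refine ⟨C, fun t ht => le_trans ?_ (hC t ht)⟩
  rw [moment_two_eq_sum]
  exact Finset.single_le_sum (f := fun j => ∫⁻ x, ‖x j‖ₑ ^ 2 * ‖propagator H t ψ x‖ₑ ^ 2 ∂μ)
    (fun _ _ => zero_le) (Finset.mem_univ j)

theorem StrongMomentTransport.averaged {p : ℝ} (hp : 0 < p) {ψ : StateSpace μ}
    (hb : LocallyBoundedMoment H (2 * p) ψ) (h : StrongMomentTransport H p ψ) :
    AveragedStrongMomentTransport H p ψ := by
  refine StrongTransportFor.averaged (fun _ => by fun_prop) hp (fun _ T => ?_) h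
  obtain ⟨C, hC⟩ := hb T
  exact ⟨C, fun t ht => (moment_two_mul_eq p hp ψ t).symm.le.trans (hC t ht)⟩

end Transport

/-! ### Moment lower bounds from strong resolvent convergence. -/

section Resolvent

variable {d : ℕ} {μ : Measure (EuclideanSpace ℝ (Fin d))}
  {H : StateSpace μ →ₗ.[ℂ] StateSpace μ}

theorem norm_sq_ofReal_sub_I (l : ℝ) : ‖(l : ℂ) - Complex.I‖ ^ 2 = 1 + l ^ 2 := by
  rw [Complex.sq_norm, Complex.normSq_apply]
  simp
  ring

/-- The equation `(f(t)/t - i) η = φ` for a Heisenberg-evolved multiplication operator `f(t)` has a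
solution. -/
theorem exists_resolvent_solution {f : EuclideanSpace ℝ (Fin d) → ℝ} (hf : Measurable f) {t : ℝ}
    (ht : 0 < t) (φ : StateSpace μ) :
    ∃ η : (((t : ℂ)⁻¹) • heisenberg H (mulOperator f) t).domain,
      (((t : ℂ)⁻¹) • heisenberg H (mulOperator f) t) η - Complex.I • (η : StateSpace μ) = φ := by
  set χ : StateSpace μ := propagator H t φ with hχ
  -- After conjugation by the propagator the resolvent is multiplication by `b`. Since `|f b| ≤ t`,
  -- the product `b χ` lies in the domain.
  set b : EuclideanSpace ℝ (Fin d) → ℂ := fun x => (((f x / t : ℝ) : ℂ) - Complex.I)⁻¹ with hb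
  have hbm : Measurable b := by fun_prop
  have hz : ∀ l : ℝ, (l : ℂ) - Complex.I ≠ 0 := fun l h => by
    have := congrArg Complex.im h
    simp at this
  have hb1 : ∀ x, ‖b x‖ ≤ 1 := fun x => by
    rw [hb, norm_inv]
    refine inv_le_one_of_one_le₀ ?_
    nlinarith [norm_sq_ofReal_sub_I (f x / t), norm_nonneg (((f x / t : ℝ) : ℂ) - Complex.I),
      sq_nonneg (f x / t)]
  have hfb : ∀ x, ‖(f x : ℂ) * b x‖ ≤ t := fun x => by
    rw [hb, norm_mul, norm_inv, Complex.norm_real, ← div_eq_mul_inv,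
      div_le_iff₀ (norm_pos_iff.2 (hz _)), ← div_le_iff₀' ht]
    refine (sq_le_sq₀ (by positivity) (norm_nonneg _)).1 ?_
    rw [norm_sq_ofReal_sub_I, div_pow, Real.norm_eq_abs, sq_abs, div_pow]
    linarith
  have hmem : MemLp (fun x => b x * χ x) 2 μ :=
    (Lp.memLp χ).of_le_mul (c := 1) (hbm.aestronglyMeasurable.mul (Lp.aestronglyMeasurable χ))
      (ae_of_all _ fun x => by
        rw [norm_mul]
        exact mul_le_mul_of_nonneg_right (hb1 x) (norm_nonneg _))
  set ξ : StateSpace μ := hmem.toLp with hξ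
  have hξe : ξ =ᵐ[μ] fun x => b x * χ x := hmem.coeFn_toLp
  have hdom : ξ ∈ (mulOperator f : StateSpace μ →ₗ.[ℂ] StateSpace μ).domain := by
    have hfm : Measurable fun x => (f x : ℂ) := by fun_prop
    refine (Lp.memLp χ).of_le_mul (c := t)
      (hfm.aestronglyMeasurable.mul (Lp.aestronglyMeasurable ξ)) ?_
    filter_upwards [hξe] with x hx
    rw [hx, ← mul_assoc, norm_mul]
    exact mul_le_mul_of_nonneg_right (hfb x) (norm_nonneg _)
  have heq : ((t : ℂ)⁻¹) • (mulOperator f ⟨ξ, hdom⟩ : StateSpace μ) - Complex.I • ξ = χ := by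
    refine Lp.ext ?_
    filter_upwards [hξe, mulOperator_ae_eq hdom, Lp.coeFn_smul Complex.I ξ,
      Lp.coeFn_smul ((t : ℂ)⁻¹) (mulOperator f ⟨ξ, hdom⟩ : StateSpace μ),
      Lp.coeFn_sub (((t : ℂ)⁻¹) • (mulOperator f ⟨ξ, hdom⟩ : StateSpace μ)) (Complex.I • ξ)]
      with x h1 h2 h3 h4 h5
    rw [h5, Pi.sub_apply, h4, h3, Pi.smul_apply, Pi.smul_apply, h2, h1, smul_eq_mul, smul_eq_mul]
    have h6 := mul_inv_cancel₀ (hz (f x / t))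
    push_cast at h6
    simp only [hb]
    push_cast
    linear_combination (χ x) * h6
  have hdom' : (propagator H t).symm ξ ∈ (heisenberg H (mulOperator f) t).domain := by
    change propagator H t ((propagator H t).symm ξ) ∈ (mulOperator f).domain
    rwa [LinearIsometryEquiv.apply_symm_apply]
  refine ⟨⟨(propagator H t).symm ξ, hdom'⟩, (propagator H t).injective ?_⟩
  rw [map_sub, map_smul, LinearPMap.smul_apply, map_smul, LinearIsometryEquiv.apply_symm_apply,
    ← hχ, ← heq]
  congr 2
  refine ((propagator H t).apply_symm_apply _).trans ?_
  congr 1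
  exact Subtype.ext ((propagator H t).apply_symm_apply ξ)

/-- The pointwise bound `u ≤ u / (1 + l²) + δ² u + (|l| / δ)^p u`, with `v = u / (1 + l²)`. -/
theorem le_add_of_resolvent {p l δ u v : ℝ} (hp : 0 < p) (hδ : 0 < δ) (hv : 0 ≤ v)
    (h : u = (1 + l ^ 2) * v) : u ≤ v + δ ^ 2 * u + (|l| / δ) ^ p * u := by
  have hu : 0 ≤ u := by rw [h]; positivity
  have hvu : v ≤ u := by nlinarith [sq_nonneg l]
  -- For `|l| ≤ δ` the loss `u - v = l² v` is at most `δ² u`; for `|l| ≥ δ` the last term alone is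
  -- at least `u`.
  rcases le_total |l| δ with h1 | h1
  · have h2 : l ^ 2 ≤ δ ^ 2 := by
      rw [← sq_abs l]
      gcongr
    have h3 : 0 ≤ (|l| / δ) ^ p * u := by positivity
    nlinarith [mul_le_mul h2 hvu hv (sq_nonneg δ)]
  · have h2 : 1 ≤ (|l| / δ) ^ p := Real.one_le_rpow ((one_le_div hδ).2 h1) hp.le
    nlinarith [mul_nonneg (sq_nonneg δ) hu]

/-- The mass of `φ` that the resolvent of `f(t)/t` loses is bounded by the `p`-th moment. -/
theorem enorm_sq_le_resolventAt_add_moment {f : EuclideanSpace ℝ (Fin d) → ℝ} (hf : Measurable f)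
    (hfn : ∀ x, |f x| ≤ ‖x‖) {p t δ : ℝ} (hp : 0 < p) (ht : 0 < t) (hδ : 0 < δ)
    (φ : StateSpace μ) :
    ‖φ‖ₑ ^ 2 ≤ ‖resolventAt (((t : ℂ)⁻¹) • heisenberg H (mulOperator f) t) Complex.I φ‖ₑ ^ 2 +
      ENNReal.ofReal (δ ^ 2) * ‖φ‖ₑ ^ 2 +
      ENNReal.ofReal (((δ * t)⁻¹) ^ p) * moment H p φ t := by
  have hex := exists_resolvent_solution (H := H) hf ht φ
  rw [resolventAt, dif_pos hex]
  have heq := hex.choose_spec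
  set η := hex.choose
  have hdom : propagator H t (η : StateSpace μ) ∈
    (mulOperator f : StateSpace μ →ₗ.[ℂ] StateSpace μ).domain := η.2
  set ξ : StateSpace μ := propagator H t (η : StateSpace μ) with hξ
  set χ : StateSpace μ := propagator H t φ with hχ
  have heq' : ((t : ℂ)⁻¹) • (mulOperator f ⟨ξ, hdom⟩ : StateSpace μ) - Complex.I • ξ = χ := by
    rw [hχ, ← heq, map_sub, map_smul, LinearPMap.smul_apply, map_smul]
    congr 2
    exact ((propagator H t).apply_symm_apply _).symm
  have hη : ‖(η : StateSpace μ)‖ₑ = ‖ξ‖ₑ := by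
    rw [hξ, ← ofReal_norm, ← ofReal_norm, LinearIsometryEquiv.norm_map]
  have hφ : ‖φ‖ₑ = ‖χ‖ₑ := by
    rw [hχ, ← ofReal_norm, ← ofReal_norm, LinearIsometryEquiv.norm_map]
  have hξm : AEMeasurable (fun x => ‖ξ x‖ₑ ^ 2) μ := (Lp.aestronglyMeasurable ξ).enorm.pow_const 2
  have hχm : AEMeasurable (fun x => ‖χ x‖ₑ ^ 2) μ := (Lp.aestronglyMeasurable χ).enorm.pow_const 2
  have hsum : AEMeasurable (fun x => ‖ξ x‖ₑ ^ 2 + ENNReal.ofReal (δ ^ 2) * ‖χ x‖ₑ ^ 2) μ :=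
    hξm.add (hχm.const_mul _)
  rw [hη, hφ, enorm_sq_eq_lintegral, enorm_sq_eq_lintegral ξ, moment,
    ← lintegral_const_mul' _ _ ENNReal.ofReal_ne_top,
    ← lintegral_const_mul' _ _ ENNReal.ofReal_ne_top, ← lintegral_add_left' hξm,
    ← lintegral_add_left' hsum]
  refine lintegral_mono_ae ?_
  filter_upwards [mulOperator_ae_eq hdom, Lp.coeFn_smul Complex.I ξ,
    Lp.coeFn_smul ((t : ℂ)⁻¹) (mulOperator f ⟨ξ, hdom⟩ : StateSpace μ),
    Lp.coeFn_sub (((t : ℂ)⁻¹) • (mulOperator f ⟨ξ, hdom⟩ : StateSpace μ)) (Complex.I • ξ)]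
    with x h2 h3 h4 h5
  rw [heq', Pi.sub_apply, h4, h3, Pi.smul_apply, Pi.smul_apply, h2, smul_eq_mul, smul_eq_mul]
    at h5
  have h6 : ‖χ x‖ ^ 2 = (1 + (f x / t) ^ 2) * ‖ξ x‖ ^ 2 := by
    rw [h5, ← norm_sq_ofReal_sub_I, ← mul_pow, ← norm_mul]
    congr 2
    push_cast
    ring
  have h7 := le_add_of_resolvent hp hδ (sq_nonneg _) h6
  have h8 : (|f x / t| / δ) ^ p ≤ ((δ * t)⁻¹) ^ p * ‖x‖ ^ p := by
    rw [← Real.mul_rpow (by positivity) (norm_nonneg _), abs_div, abs_of_pos ht]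
    refine Real.rpow_le_rpow (by positivity) ?_ hp.le
    rw [div_div, mul_comm t δ, div_eq_inv_mul]
    gcongr
    exact hfn x
  rw [← ofReal_norm, ← ofReal_norm, ← ofReal_norm, ENNReal.ofReal_rpow_of_nonneg (norm_nonneg _)
    hp.le, ← ENNReal.ofReal_pow (norm_nonneg _), ← ENNReal.ofReal_pow (norm_nonneg _),
    ← ENNReal.ofReal_mul (by positivity), ← ENNReal.ofReal_mul (by positivity),
    ← ENNReal.ofReal_mul (by positivity), ← ENNReal.ofReal_add (by positivity) (by positivity),
    ← ENNReal.ofReal_add (by positivity) (by positivity)]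
  refine ENNReal.ofReal_le_ofReal (h7.trans ?_)
  rw [← mul_assoc]
  gcongr

/-- If `f(t)/t → P` in the strong resolvent sense for some `|f(q)| ≤ ‖q‖` and `φ ∉ ker P`, then
the `p`-th moment of `φ` grows at least like `t^p`. -/
theorem lowerGrowth_moment_of_strongResolventTendsto {f : EuclideanSpace ℝ (Fin d) → ℝ}
    (hf : Measurable f) (hfn : ∀ x, |f x| ≤ ‖x‖) {p : ℝ} (hp : 0 < p)
    {P : StateSpace μ →ₗ.[ℂ] StateSpace μ} (hP : IsSelfAdjoint P)
    (h : StrongResolventTendsto (fun t : ℝ => ((t : ℂ)⁻¹) • heisenberg H (mulOperator f) t) P)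
    {φ : StateSpace μ} (hφ : ¬ InKernel P φ) : LowerGrowth p (moment H p φ) := by
  have hsymm : P.IsFormalAdjoint P := by
    have := LinearPMap.adjoint_isFormalAdjoint hP.dense_domain
    rwa [LinearPMap.isSelfAdjoint_def.1 hP] at this
  have hlt := norm_resolventAt_I_lt hsymm hφ
  set D : ℝ := ‖φ‖ ^ 2 - ‖resolventAt P Complex.I φ‖ ^ 2 with hD
  have hD0 : 0 < D := sub_pos.2 (by gcongr)
  have hφ0 : 0 < ‖φ‖ := (norm_nonneg _).trans_lt hlt
  -- Of the limiting loss `D`, at least `D/2` persists for large `t`. This `δ` limits the inner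
  -- region to `D/4`, and a moment below `(D/4) (δ t)^p` would leave less than the required total.
  set δ : ℝ := Real.sqrt (D / 4) / ‖φ‖ with hδ
  have hδ0 : 0 < δ := by positivity
  have hδD : δ ^ 2 * ‖φ‖ ^ 2 = D / 4 := by
    rw [hδ, div_pow, Real.sq_sqrt (by positivity)]
    field_simp
  have hlim := ((h Complex.I (by simp) φ).norm.pow 2).eventually
    (gt_mem_nhds (by linarith : _ < ‖resolventAt P Complex.I φ‖ ^ 2 + D / 2))
  refine ⟨D / 4 * δ ^ p, by positivity, ?_⟩
  filter_upwards [hlim, eventually_gt_atTop 0] with t h1 ht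
  by_contra! hlow
  have hmain := enorm_sq_le_resolventAt_add_moment (H := H) hf hfn hp ht hδ0 φ
  set R := resolventAt (((t : ℂ)⁻¹) • heisenberg H (mulOperator f) t) Complex.I φ
  have hlast : ENNReal.ofReal (((δ * t)⁻¹) ^ p) * moment H p φ t ≤ ENNReal.ofReal (D / 4) := by
    refine (mul_le_mul_right hlow.le _).trans (le_of_eq ?_)
    rw [← ENNReal.ofReal_mul (by positivity), mul_assoc, ← Real.mul_rpow hδ0.le ht.le,
      mul_left_comm, ← Real.mul_rpow (by positivity) (by positivity),
      inv_mul_cancel₀ (by positivity), Real.one_rpow, mul_one]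
  have hfin := hmain.trans (add_le_add_right hlast _)
  rw [← ofReal_norm, ← ofReal_norm, ← ENNReal.ofReal_pow (norm_nonneg _),
    ← ENNReal.ofReal_pow (norm_nonneg _), ← ENNReal.ofReal_mul (by positivity),
    ← ENNReal.ofReal_add (by positivity) (by positivity),
    ← ENNReal.ofReal_add (by positivity) (by positivity),
    ENNReal.ofReal_le_ofReal_iff (by positivity)] at hfin
  linarith

theorem abs_apply_le_norm (x : EuclideanSpace ℝ (Fin d)) (j : Fin d) : |x j| ≤ ‖x‖ := by
  simpa using PiLp.norm_apply_le x j

/-- If `Q_j(t)/t → P_j` in the strong resolvent sense for all `j`, then the transport exponents are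
`1` for all states outside `⋂_j ker P_j` for which they are at most `1`. -/
theorem exponentsEqOne_of_strongResolventTendsto {p : ℝ} (hp : 0 < p)
    {P : Fin d → StateSpace μ →ₗ.[ℂ] StateSpace μ} (hP : ∀ j, IsSelfAdjoint (P j))
    (h : ∀ j, StrongResolventTendsto
      (fun t : ℝ => ((t : ℂ)⁻¹) • heisenberg H (position j) t) (P j))
    {φ : StateSpace μ} (hu : upperExponent p (moment H p φ) ≤ 1)
    (hφ : ¬ ∀ j, InKernel (P j) φ) : ExponentsEqOne p (moment H p φ) := by
  obtain ⟨j, hj⟩ := not_forall.1 hφ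
  have hl : LowerGrowth p (moment H p φ) :=
    lowerGrowth_moment_of_strongResolventTendsto (f := fun x => x j) (by fun_prop)
      (fun x => abs_apply_le_norm x j) hp (hP j) (h j) hj
  exact exponentsEqOne_of_bounds hu
    ((one_le_lowerExponent_iff hp).2 fun q _ hq => hl.mono_exponent hq.le)

end Resolvent

end BallisticTransport

theorem proposition3p1 {d : ℕ} (μ : Measure (EuclideanSpace ℝ (Fin d)))
    (hμ : μ = volume ∨ μ = latticeMeasure d)
    (H : StateSpace μ →ₗ.[ℂ] StateSpace μ) (hH : IsSelfAdjoint H) :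
    -- Strong resolvent convergence and ballistic upper bounds on `W` give exponents `1` on `W`.
    (∀ p : ℝ, 0 < p → ∀ W : Set (StateSpace μ),
      (∀ ψ ∈ W, upperExponent p (moment H p ψ) ≤ 1 ∧ lowerExponent p (moment H p ψ) ≤ 1) →
      ∀ P : Fin d → StateSpace μ →ₗ.[ℂ] StateSpace μ,
        (∀ j, IsSelfAdjoint (P j)) →
        (∀ j, StrongResolventTendsto
          (fun t : ℝ => ((t : ℂ)⁻¹) • heisenberg H (position j) t) (P j)) →
        (∀ ψ ∈ W, (∀ j, InKernel (P j) ψ) → ψ = 0) →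
        ∀ ψ ∈ W, ψ ≠ 0 → ExponentsEqOne p (moment H p ψ)) ∧
    -- Strong transport implies norm growth.
    (∀ ψ, StrongTransport H ψ → NormGrowth 2 (moment H 2 ψ)) ∧
    (∀ p : ℝ, 0 < p → ∀ ψ, StrongMomentTransport H p ψ →
      NormGrowth (2 * p) (moment H (2 * p) ψ)) ∧
    -- Norm growth implies exponents `1`.
    (∀ p : ℝ, 0 < p → ∀ ψ, NormGrowth p (moment H p ψ) → ExponentsEqOne p (moment H p ψ)) ∧
    -- Norm growth implies Abel-averaged norm growth.
    (∀ p : ℝ, 0 < p → ∀ ψ, LocallyBoundedMoment H p ψ → NormGrowth p (moment H p ψ) →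
      NormGrowth p (abelMean (moment H p ψ))) ∧
    -- Abel-averaged norm growth implies Abel-averaged exponents `1`.
    (∀ p : ℝ, 0 < p → ∀ ψ, NormGrowth p (abelMean (moment H p ψ)) →
      ExponentsEqOne p (abelMean (moment H p ψ))) ∧
    -- Exponents `1` imply Abel- and Cesàro-averaged exponents `1`.
    (∀ p : ℝ, 0 < p → ∀ ψ, LocallyBoundedMoment H p ψ → ExponentsEqOne p (moment H p ψ) →
      ExponentsEqOne p (abelMean (moment H p ψ)) ∧
      ExponentsEqOne p (cesaroMean (moment H p ψ))) ∧
    -- Every notion implies its Cesàro-averaged analogue.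
    (∀ ψ, LocallyBoundedMoment H 2 ψ → StrongTransport H ψ → AveragedStrongTransport H ψ) ∧
    (∀ p : ℝ, 0 < p → ∀ ψ, LocallyBoundedMoment H (2 * p) ψ → StrongMomentTransport H p ψ →
      AveragedStrongMomentTransport H p ψ) ∧
    (∀ p : ℝ, 0 < p → ∀ ψ, LocallyBoundedMoment H p ψ →
      (NormGrowth p (moment H p ψ) → NormGrowth p (cesaroMean (moment H p ψ))) ∧
      (ExponentsEqOne p (moment H p ψ) → ExponentsEqOne p (cesaroMean (moment H p ψ))) ∧
      (NormGrowth p (abelMean (moment H p ψ)) →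
        NormGrowth p (abelMean (cesaroMean (moment H p ψ)))) ∧
      (ExponentsEqOne p (abelMean (moment H p ψ)) →
        ExponentsEqOne p (abelMean (cesaroMean (moment H p ψ))))) := by
  refine ⟨fun p hp W hW P hP hQ hker ψ hψ hψ0 => ?_, fun ψ h => h.normGrowth,
    fun p hp ψ h => h.normGrowth hp, fun p hp ψ h => h.exponentsEqOne hp,
    fun p hp ψ hb h => h.abelMean hp hb, fun p hp ψ h => h.exponentsEqOne hp,
    fun p hp ψ hb h => ⟨h.abelMean hp hb, h.cesaroMean hp hb⟩, fun ψ hb h => h.averaged hb,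
    fun p hp ψ hb h => h.averaged hp hb,
    fun p hp ψ hb => ⟨fun h => h.cesaroMean hp hb, fun h => h.cesaroMean hp hb,
      fun h => h.abelMean_cesaroMean hp hb, fun h => h.abelMean_cesaroMean hp hb⟩⟩
  exact exponentsEqOne_of_strongResolventTendsto hp hP hQ (hW ψ hψ).1
    fun h => hψ0 (hker ψ hψ h)
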